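/- Let $\mathcal L$ be a countable first-order language, and equip the set of all $\mathcal L$-structures with universe $\omega$ with its usual Polish topology (generated by the sets that prescribe one value of one function symbol, or one truth value of one relation symbol, at one tuple). For a countable set $T$ of $\mathcal L_{\omega_1\omega}$-sentences let $\mathrm{Mod}(T)$ be the set of models of $T$ with universe $\omega$. For such theories $T$ and $S$, possibly in different countable languages, $T$ is Borel reducible to $S$ if there is a Borel function $f:\mathrm{Mod}(T)\to\mathrm{Mod}(S)$ such that $f(M)\cong f(N)$ if and only if $M\cong N$, for all $M,N\in\mathrm{Mod}(T)$. The theory $S$ is Borel complete if every such $T$, in every countable language, is Borel reducible to $S$. Let $R$ be a countable commutative ring with unit. An ideal $I$ of $R$ is an annihilator ideal if there is a subset $X\subseteq R$ with $I=\{a\in R : ax=0 \text{ for all } x\in X\}$. Theorem. Suppose that there is an infinite descending sequence $I_0\supseteq I_1\supseteq I_2\supseteq\cdots$ of non-zero annihilator ideals of $R$ with $\bigcap_{n\in\omega} I_n=0$. Then the theory of (unital) $R$-modules, in the language $\{+,0\}\cup\{\cdot_r : r\in R\}$, is Borel complete. -/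

import Mathlib

universe u v u' v' w

/-! ## The logic `L_{ω₁ω}` -/

/-- Formulas of the infinitary logic `L_{ω₁ω}` over the first-order language `L` whose free variables
are among `x_0, …, x_{n-1}`: atomic formulas, negation, conjunctions and disjunctions of countable
families, and the two quantifiers, which bind the variable `x_n`. Subformulas of a sentence only have
finitely many free variables, so this yields all the sentences of `L_{ω₁ω}`. -/
inductive InfFormula (L : FirstOrder.Language.{u, v}) : ℕ → Type (max u v)
  | equal {n : ℕ} (s t : L.Term (Fin n)) : InfFormula L n
  | rel {n k : ℕ} (r : L.Relations k) (ts : Fin k → L.Term (Fin n)) : InfFormula L n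
  | neg {n : ℕ} (φ : InfFormula L n) : InfFormula L n
  | conj {n : ℕ} (φ : ℕ → InfFormula L n) : InfFormula L n
  | disj {n : ℕ} (φ : ℕ → InfFormula L n) : InfFormula L n
  | all {n : ℕ} (φ : InfFormula L (n + 1)) : InfFormula L n
  | ex {n : ℕ} (φ : InfFormula L (n + 1)) : InfFormula L n

/-- Tarskian satisfaction of an `L_{ω₁ω}`-formula in the `L`-structure `A` at the assignment `x`. -/
def InfFormula.Realize {L : FirstOrder.Language.{u, v}} (A : Type w) [L.Structure A] :
    {n : ℕ} → InfFormula L n → (Fin n → A) → Prop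
  | _, .equal s t, x => s.realize x = t.realize x
  | _, .rel r ts, x => FirstOrder.Language.Structure.RelMap r (fun i => (ts i).realize x)
  | _, .neg φ, x => ¬ φ.Realize A x
  | _, .conj φ, x => ∀ i, (φ i).Realize A x
  | _, .disj φ, x => ∃ i, (φ i).Realize A x
  | _, .all φ, x => ∀ a : A, φ.Realize A (Fin.snoc (α := fun _ => A) x a)
  | _, .ex φ, x => ∃ a : A, φ.Realize A (Fin.snoc (α := fun _ => A) x a)

/-- Sentences of `L_{ω₁ω}`. -/
abbrev InfSentence (L : FirstOrder.Language.{u, v}) : Type (max u v) := InfFormula L 0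

/-! ## The space of structures with universe `ω`, and Borel reducibility -/

/-- The usual topology on the space of all `L`-structures with universe `ℕ`: it is generated by the
sets fixing one value of one function symbol, or one truth value of one relation symbol. This is the
product topology obtained from the discrete topologies on `ℕ` and on the two truth values. -/
instance structureTopology (L : FirstOrder.Language.{u, v}) : TopologicalSpace (L.Structure ℕ) :=
  TopologicalSpace.generateFrom
    ({U | ∃ (k : ℕ) (f : L.Functions k) (x : Fin k → ℕ) (y : ℕ),
        U = {M : L.Structure ℕ | M.funMap f x = y}} ∪
     {U | ∃ (k : ℕ) (r : L.Relations k) (x : Fin k → ℕ),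
        U = {M : L.Structure ℕ | M.RelMap r x}} ∪
     {U | ∃ (k : ℕ) (r : L.Relations k) (x : Fin k → ℕ),
        U = {M : L.Structure ℕ | ¬ M.RelMap r x}})

/-- The Borel `σ`-algebra on the space of `L`-structures with universe `ℕ`. -/
instance structureMeasurableSpace (L : FirstOrder.Language.{u, v}) : MeasurableSpace (L.Structure ℕ) :=
  borel (L.Structure ℕ)

/-- Isomorphism of two `L`-structures with universe `ℕ`. -/
def StructureIso {L : FirstOrder.Language.{u, v}} (M N : L.Structure ℕ) : Prop :=
  Nonempty (@FirstOrder.Language.Equiv L ℕ ℕ M N)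

/-- `Mod(T)`: the set of all models with universe `ℕ` of a set `T` of `L_{ω₁ω}`-sentences. -/
def ModelsOf {L : FirstOrder.Language.{u, v}} (T : Set (InfSentence L)) : Set (L.Structure ℕ) :=
  {M | ∀ φ ∈ T, @InfFormula.Realize L ℕ M 0 φ Fin.elim0}

/-- `T ≤_B S`: there is a Borel function `f : Mod(T) → Mod(S)` such that `f M ≅ f N ↔ M ≅ N`
for all `M, N` in `Mod(T)`. -/
def BorelReducible {L : FirstOrder.Language.{u, v}} {L' : FirstOrder.Language.{u', v'}}
    (T : Set (InfSentence L)) (S : Set (InfSentence L')) : Prop :=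
  ∃ f : ModelsOf T → ModelsOf S, Measurable f ∧
    ∀ M N : ModelsOf T, StructureIso (f M).1 (f N).1 ↔ StructureIso M.1 N.1

/-- `S` is Borel complete: it is maximal for Borel reducibility, that is, `T ≤_B S` for every countable
set `T` of `L_{ω₁ω}`-sentences (equivalently, a single sentence) in any countable language `L`.
Every countable language has an isomorphic copy in the lowest universe. -/
def IsBorelComplete {L' : FirstOrder.Language.{u', v'}} (S : Set (InfSentence L')) : Prop :=
  ∀ (L : FirstOrder.Language.{0, 0}), Countable L.Symbols →
    ∀ T : Set (InfSentence L), T.Countable → BorelReducible T S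

/-! ## The theory of (left) `R`-modules -/

/-- The function symbols `0`, `+` and `r ·` (for `r ∈ R`) of the language of left `R`-modules. -/
inductive ModuleFunc (R : Type u) : ℕ → Type u
  | zero : ModuleFunc R 0
  | add : ModuleFunc R 2
  | smul (r : R) : ModuleFunc R 1

/-- The language `{+, 0, ·_r}_{r ∈ R}` of left `R`-modules; it has no relation symbols. -/
def moduleLanguage (R : Type u) : FirstOrder.Language.{u, 0} := ⟨ModuleFunc R, fun _ => Empty⟩

namespace ModuleTerm

variable {R : Type u} {n : ℕ}

/-- The variable `x_i`. -/
def x (i : Fin n) : (moduleLanguage R).Term (Fin n) := FirstOrder.Language.Term.var i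

/-- The constant `0`. -/
def zero : (moduleLanguage R).Term (Fin n) :=
  FirstOrder.Language.Constants.term (L := moduleLanguage R) (ModuleFunc.zero : ModuleFunc R 0)

/-- The term `s + t`. -/
def add (s t : (moduleLanguage R).Term (Fin n)) : (moduleLanguage R).Term (Fin n) :=
  FirstOrder.Language.Functions.apply₂ (L := moduleLanguage R) (ModuleFunc.add : ModuleFunc R 2) s t

/-- The term `r · t`. -/
def smul (r : R) (t : (moduleLanguage R).Term (Fin n)) : (moduleLanguage R).Term (Fin n) :=
  FirstOrder.Language.Functions.apply₁ (L := moduleLanguage R) (ModuleFunc.smul r : ModuleFunc R 1) t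

end ModuleTerm

/-- The axioms of unital left `R`-modules, one for each axiom of an abelian group and one for each
instance of the four laws of scalar multiplication. -/
inductive ModuleAxiom (R : Type u) : Type u
  | addAssoc | addComm | addZero | addNeg
  | smulAdd (r : R) | addSmul (r s : R) | mulSmul (r s : R) | oneSmul

open ModuleTerm InfFormula in
/-- The sentence expressing an axiom of left `R`-modules. -/
def ModuleAxiom.toSentence {R : Type u} [Ring R] : ModuleAxiom R → InfSentence (moduleLanguage R)
  | .addAssoc => all (all (all (equal (add (add (x 0) (x 1)) (x 2)) (add (x 0) (add (x 1) (x 2))))))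
  | .addComm => all (all (equal (add (x 0) (x 1)) (add (x 1) (x 0))))
  | .addZero => all (equal (add (x 0) zero) (x 0))
  | .addNeg => all (ex (equal (add (x 0) (x 1)) zero))
  | .smulAdd r => all (all (equal (smul r (add (x 0) (x 1))) (add (smul r (x 0)) (smul r (x 1)))))
  | .addSmul r s => all (equal (smul (r + s) (x 0)) (add (smul r (x 0)) (smul s (x 0))))
  | .mulSmul r s => all (equal (smul (r * s) (x 0)) (smul r (smul s (x 0))))
  | .oneSmul => all (equal (smul 1 (x 0)) (x 0))

/-- The theory of left `R`-modules. -/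
def moduleTheory (R : Type u) [Ring R] : Set (InfSentence (moduleLanguage R)) :=
  Set.range ModuleAxiom.toSentence

/-! ## Annihilator ideals -/

/-- `I` is an annihilator ideal: `I = Ann_R(X)` for some subset `X` of `R`. -/
def IsAnnihilatorIdeal {R : Type u} [CommRing R] (I : Ideal R) : Prop :=
  ∃ X : Set R, ∀ a : R, a ∈ I ↔ ∀ x ∈ X, a * x = 0

/-! Let J be the union of the annihilators of the I_n, a proper ideal, 𝔪 a maximal ideal containing
J, and k = R/𝔪. A diagonal construction (`GenericSystem.nonempty`) gives a subsequence K_n of the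
ideals and coherent sequences s_n(i) in J whose limits γ_i in ∏ R/K_n are generic: a quadratic
relation of the form in `QuadDatum` that holds at the limits vanishes identically on a neighbourhood
of some approximation s_n.

Given subspaces U_i of k^(X), attach to each P ⊆ X the module M_P of sums f + ∑ γ_j u_j, with f and
u_j finitely supported in P. There are two coefficients γ_(i,false), γ_(i,true) for each i, and both
u_(i,b) must reduce into U_i modulo 𝔪. The relation m' = γ_j m is expressed by equations with
scalars from R (`Scaled`), so homomorphisms respect it. Genericity shows that f modulo 𝔪 depends
only on the element, that the kernel of this reduction is intrinsic (`ker_tagReduction`), and that f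
reduces into U_i as soon as both products of the element by the γ_(i,b) lie in M_P. Hence an
isomorphism of M_P with M_P' carries elements reducing into U_i to elements reducing into U_i.
Conversely a permutation of X that carries P onto P' and preserves every U_i induces an isomorphism.

It remains to find countably many U_i that are rigid and homogeneous at once. Let X = κ × ℕ, where κ
is the set of possible atomic facts about structures on ℕ. For rigidity, every vector with at least
two nonzero coordinates lies in some U_i without monomials, so isomorphisms send basis vectors to
multiples of basis vectors (`exists_equiv_of_equiv`). For homogeneity, every permutation of κ that
preserves kinds and equality of entries lifts to X and preserves all the U_i
(`RichFamily.exists_perm`). The ℕ fresh copies of each fact make the two demands compatible: partial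
maps are extended freely by a new copy (`exists_closed_noMonomial_insert`). Further U_i record kinds
and entries, so the module over the true facts of a structure determines that structure up to
isomorphism. All these modules lie in one countable module, and counting enumerates them in a Borel
way. -/

/-! ## Generic sequences of coefficients -/

/-- The data of a quadratic polynomial `φ' + ∑ u'_i r_i - r_j (φ + ∑ u_i r_i)`. -/
structure QuadDatum (R : Type u) [CommRing R] (Γ : Type v) where
  idx : Γ
  c : R
  c' : R
  lin : Γ →₀ R
  lin' : Γ →₀ R

namespace QuadDatum
variable {R : Type u} [CommRing R] {Γ : Type v}

/-- The value of the quadratic polynomial at `r`. -/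
noncomputable def eval (d : QuadDatum R Γ) (r : Γ → R) : R :=
  d.c' + Finsupp.linearCombination R r d.lin'
    - r d.idx * (d.c + Finsupp.linearCombination R r d.lin)

instance [Countable R] [Countable Γ] : Countable (QuadDatum R Γ) := by
  have : Function.Injective (fun d : QuadDatum R Γ => (d.idx, d.c, d.c', d.lin, d.lin')) := by
    rintro ⟨⟩ ⟨⟩ h
    simpa using h
  exact this.countable

instance [Nonempty Γ] : Nonempty (QuadDatum R Γ) := ⟨⟨Classical.arbitrary Γ, 0, 0, 0, 0⟩⟩

end QuadDatum

theorem Finsupp.linearCombination_add_left {R : Type u} [CommRing R] {Γ : Type v} (r a : Γ → R)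
    (u : Γ →₀ R) : Finsupp.linearCombination R (r + a) u =
      Finsupp.linearCombination R r u + Finsupp.linearCombination R a u := by
  simp [Finsupp.linearCombination_apply, Finsupp.sum, mul_add, Finset.sum_add_distrib]

theorem Finsupp.linearCombination_mem_ideal {R : Type u} [CommRing R] {Γ : Type v} (J : Ideal R)
    {r : Γ → R} (hr : ∀ i, r i ∈ J) (u : Γ →₀ R) : Finsupp.linearCombination R r u ∈ J := by
  rw [Finsupp.linearCombination_apply]
  exact J.sum_mem fun i _ => J.mul_mem_left _ (hr i)

/-- A descending sequence of annihilator ideals with zero intersection, together with a compatible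
sequence of coefficient families at which every quadratic polynomial that vanishes in the limit
vanishes on a neighbourhood. -/
structure GenericSystem (R : Type u) [CommRing R] (Γ : Type v) where
  K : ℕ → Ideal R
  J : Ideal R
  s : ℕ → Γ → R
  J_ne_top : J ≠ ⊤
  anti : Antitone K
  inter : ∀ x, (∀ n, x ∈ K n) → x = 0
  double_ann : ∀ n x, (∀ b, (∀ y ∈ K n, b * y = 0) → b * x = 0) → x ∈ K n
  ann_inf : ∀ n x, (∀ y ∈ K n ⊓ J, x * y = 0) → x ∈ J
  s_mem : ∀ n i, s n i ∈ J
  s_step : ∀ n i, s (n + 1) i - s n i ∈ K n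
  generic : ∀ d : QuadDatum R Γ, (∀ n, d.eval (s n) ∈ K n) →
    ∃ n, ∀ a : Γ → R, (∀ i, a i ∈ K n ⊓ J) → d.eval (s n + a) = 0

/-- A Baire category argument with countably many quadratic data. At step q the q-th datum either
vanishes on the current neighbourhood, or the approximation is moved inside it to a point with
nonzero value and the ideal is shrunk until it excludes that value. -/
theorem GenericSystem.nonempty {R : Type u} [CommRing R] [Countable R] (I : ℕ → Ideal R)
    (hann : ∀ n, IsAnnihilatorIdeal (I n)) (hne : ∀ n, I n ≠ ⊥)
    (hdesc : ∀ n, I (n + 1) ≤ I n) (hinter : ⨅ n, I n = ⊥) (Γ : Type v) [Countable Γ] [Nonempty Γ] :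
    Nonempty (GenericSystem R Γ) := by
  have hanti : Antitone I := antitone_nat_of_succ_le hdesc
  have hzero : ∀ x, (∀ n, x ∈ I n) → x = 0 := fun x hx => by
    have : x ∈ ⨅ n, I n := by simpa [Ideal.mem_iInf] using hx
    simpa [hinter] using this
  have hdouble : ∀ n x, (∀ b, (∀ y ∈ I n, b * y = 0) → b * x = 0) → x ∈ I n := by
    intro n x hx
    obtain ⟨X, hX⟩ := hann n
    rw [hX]
    intro b hb
    rw [mul_comm]
    refine hx b fun y hy => ?_
    rw [mul_comm]
    exact (hX y).1 hy b hb
  -- The union of the annihilators of the I_n; it is closed under addition because the I_n decrease.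
  let J : Ideal R :=
    { carrier := {x | ∃ n, ∀ y ∈ I n, x * y = 0}
      zero_mem' := ⟨0, by simp⟩
      add_mem' := by
        rintro a b ⟨n, hn⟩ ⟨m, hm⟩
        refine ⟨max n m, fun y hy => ?_⟩
        rw [add_mul, hn y (hanti (le_max_left _ _) hy), hm y (hanti (le_max_right _ _) hy), add_zero]
      smul_mem' := by
        rintro c x ⟨n, hn⟩
        refine ⟨n, fun y hy => ?_⟩
        rw [smul_eq_mul, mul_assoc, hn y hy, mul_zero] }
  have hJ : ∀ x, x ∈ J ↔ ∃ n, ∀ y ∈ I n, x * y = 0 := fun x => Iff.rfl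
  obtain ⟨d, hd⟩ := exists_surjective_nat (QuadDatum R Γ)
  have step : ∀ (q : ℕ) (p : {p : ℕ × (Γ → R) // ∀ i, p.2 i ∈ J}),
      ∃ p' : {p : ℕ × (Γ → R) // ∀ i, p.2 i ∈ J}, p.1.1 < p'.1.1 ∧
        (∀ i, p'.1.2 i - p.1.2 i ∈ I p.1.1) ∧
        ((d q).eval p'.1.2 ∉ I p'.1.1 ∨
          ∀ a : Γ → R, (∀ i, a i ∈ I p.1.1 ⊓ J) → (d q).eval (p.1.2 + a) = 0) := by
    rintro q ⟨⟨N, r⟩, hr⟩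
    by_cases h : ∀ a : Γ → R, (∀ i, a i ∈ I N ⊓ J) → (d q).eval (r + a) = 0
    · exact ⟨⟨(N + 1, r), hr⟩, Nat.lt_succ_self N, fun i => by simp, Or.inr h⟩
    · push Not at h
      obtain ⟨a, ha, hne⟩ := h
      obtain ⟨m, hm⟩ : ∃ m, (d q).eval (r + a) ∉ I m := by
        by_contra hcon
        push Not at hcon
        exact hne (hzero _ hcon)
      refine ⟨⟨(max (N + 1) m, r + a), fun i => J.add_mem (hr i) (ha i).2⟩, ?_, fun i => ?_, Or.inl ?_⟩
      · exact lt_of_lt_of_le (Nat.lt_succ_self N) (le_max_left _ _)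
      · simpa using (ha i).1
      · exact fun hmem => hm (hanti (le_max_right _ _) hmem)
  choose next hlt hsub hgen using step
  let seq : ℕ → {p : ℕ × (Γ → R) // ∀ i, p.2 i ∈ J} := fun n =>
    Nat.rec ⟨(0, 0), fun i => J.zero_mem⟩ (fun q p => next q p) n
  have hseq : ∀ n, seq (n + 1) = next n (seq n) := fun n => rfl
  have hmono : StrictMono fun n => (seq n).1.1 := strictMono_nat_of_lt_succ fun n => by
    rw [hseq]; exact hlt _ _
  refine ⟨{ K := fun n => I (seq n).1.1, J := J, s := fun n => (seq n).1.2
            J_ne_top := ?_, anti := fun a b hab => hanti (hmono.monotone hab)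
            inter := fun x hx => hzero x fun n => hanti hmono.le_apply (hx n)
            double_ann := fun n => hdouble _
            ann_inf := ?_, s_mem := fun n => (seq n).2
            s_step := fun n i => by rw [hseq]; exact hsub _ _ i, generic := ?_ }⟩
  · rw [Ne, Ideal.eq_top_iff_one, hJ]
    rintro ⟨n, hn⟩
    exact hne n (by rw [eq_bot_iff]; exact fun y hy => by simpa using hn y hy)
  · intro n x hx
    -- For z in K_n and b in the annihilator of I_m, the product bz lies in K_n ∩ J, so b kills xz.
    -- Double annihilation puts xz in every I_m, hence xz = 0 and x annihilates K_n.
    refine (hJ x).2 ⟨(seq n).1.1, fun z hz => hzero _ fun m => hdouble m _ fun b hb => ?_⟩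
    have hbJ : b ∈ J := (hJ b).2 ⟨m, hb⟩
    have := hx (b * z) ⟨Ideal.mul_mem_left _ b hz, Ideal.mul_mem_right z J hbJ⟩
    rw [← this]; ring
  · intro e he
    obtain ⟨q, rfl⟩ := hd e
    refine ⟨q, (hgen q (seq q)).resolve_left fun h => h ?_⟩
    have := he (q + 1)
    rwa [hseq] at this

/-! ### Algebraic consequences of genericity -/

namespace GenericSystem
variable {R : Type u} [CommRing R] {Γ : Type v} (G : GenericSystem R Γ)

theorem s_sub_mem {n m : ℕ} (h : n ≤ m) (i : Γ) : G.s m i - G.s n i ∈ G.K n := by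
  induction m, h using Nat.le_induction with
  | base => simp
  | succ m hm ih =>
    have := (G.K n).add_mem (G.anti hm (G.s_step m i)) ih
    simpa using this

/-- At the approximation where the polynomial vanishes, every term except the constant one has a
factor in J. -/
theorem const_mem_of_quad (d : QuadDatum R Γ) (h : ∀ n, d.eval (G.s n) ∈ G.K n) : d.c' ∈ G.J := by
  obtain ⟨n, hn⟩ := G.generic d h
  have h0 := hn 0 fun i => Ideal.zero_mem _
  rw [add_zero, QuadDatum.eval] at h0
  have : d.c' = G.s n d.idx * (d.c + Finsupp.linearCombination R (G.s n) d.lin)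
      - Finsupp.linearCombination R (G.s n) d.lin' := by linear_combination h0
  rw [this]
  exact G.J.sub_mem (G.J.mul_mem_right _ (G.s_mem _ _))
    (Finsupp.linearCombination_mem_ideal _ (G.s_mem n) _)

theorem const_mem_of_linear [Nonempty Γ] (c : R) (u : Γ →₀ R)
    (h : ∀ n, c + Finsupp.linearCombination R (G.s n) u ∈ G.K n) : c ∈ G.J :=
  G.const_mem_of_quad ⟨Classical.arbitrary Γ, 0, c, 0, u⟩ (by simpa [QuadDatum.eval] using h)

/-- This is why each tag has two coefficients. A first difference of the second polynomial in
direction j would give the claim but for the term b²u_j, where b is the increment; in the first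
polynomial that term is a mixed second difference in directions i and j, hence zero. -/
theorem sub_mem_of_quad_pair {i j : Γ} (hij : i ≠ j) (c c₁ c₂ : R) (u u₁ u₂ : Γ →₀ R)
    (h₁ : ∀ n, QuadDatum.eval ⟨i, c, c₁, u, u₁⟩ (G.s n) ∈ G.K n)
    (h₂ : ∀ n, QuadDatum.eval ⟨j, c, c₂, u, u₂⟩ (G.s n) ∈ G.K n) : c - u₂ j ∈ G.J := by
  classical
  obtain ⟨n, hn⟩ := G.generic _ h₁
  obtain ⟨m, hm⟩ := G.generic _ h₂
  have hsq : ∀ b ∈ G.K n ⊓ G.J, b * b * u j = 0 := by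
    intro b hb
    have hz : ∀ l : Γ, (0 : R) ∈ G.K n ⊓ G.J := fun _ => Ideal.zero_mem _
    have e0 := hn 0 hz
    have e1 := hn (Pi.single i b) fun l => by
      by_cases h : l = i <;> simp_all
    have e2 := hn (Pi.single j b) fun l => by
      by_cases h : l = j <;> simp_all
    have e3 := hn (Pi.single i b + Pi.single j b) fun l => by
      refine Ideal.add_mem _ ?_ ?_
      · by_cases h : l = i <;> simp_all
      · by_cases h : l = j <;> simp_all
    rw [add_zero] at e0
    simp only [QuadDatum.eval, Finsupp.linearCombination_add_left, Pi.add_apply, Pi.single_eq_same,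
      Pi.single_eq_of_ne hij, Finsupp.linearCombination_single_index, smul_eq_mul] at e0 e1 e2 e3
    linear_combination e1 + e2 - e0 - e3
  -- The first difference in direction j shows that this element kills K ∩ J for a deep enough K;
  -- its last two summands already lie in J.
  have hx : c - u₂ j + Finsupp.linearCombination R (G.s m) u + G.s m j * u j ∈ G.J := by
    refine G.ann_inf (max n m) _ fun b hb => ?_
    have e0 := hm 0 fun _ => Ideal.zero_mem _
    have e1 := hm (Pi.single j b) fun l => by
      have : b ∈ G.K m := G.anti (le_max_right n m) hb.1
      by_cases h : l = j <;> simp_all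
    have e2 := hsq b ⟨G.anti (le_max_left n m) hb.1, hb.2⟩
    rw [add_zero] at e0
    simp only [QuadDatum.eval, Finsupp.linearCombination_add_left, Pi.add_apply, Pi.single_eq_same,
      Finsupp.linearCombination_single_index, smul_eq_mul] at e0 e1
    linear_combination e0 - e1 - e2
  have := G.J.sub_mem (G.J.sub_mem hx (Finsupp.linearCombination_mem_ideal _ (G.s_mem m) u))
    (G.J.mul_mem_right (u j) (G.s_mem m j))
  convert this using 1
  ring

end GenericSystem

/-! ## Subspaces invariant under finite partial injections -/

section PartialMaps

variable {k : Type u} [Field k] {X : Type v}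

/-- The subspace `S` of `k^(X)` is invariant under the partial map with graph `f`. -/
def GraphClosed (f : Finset (X × X)) (S : Submodule k (X →₀ k)) : Prop :=
  ∀ Z ∈ Finsupp.supported k k (f : Set (X × X)),
    Finsupp.mapDomain Prod.fst Z ∈ S ↔ Finsupp.mapDomain Prod.snd Z ∈ S

/-- `f` is the graph of a partial injection. -/
def IsPartialInj (f : Finset (X × X)) : Prop :=
  ∀ p ∈ f, ∀ q ∈ f, p.1 = q.1 ↔ p.2 = q.2

/-- `S` contains no nonzero multiple of a basis vector. -/
def NoMonomial (S : Submodule k (X →₀ k)) : Prop :=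
  ∀ x c, Finsupp.single x c ∈ S → c = 0

theorem IsPartialInj.injOn_fst {f : Finset (X × X)} (hf : IsPartialInj f) :
    Set.InjOn Prod.fst (f : Set (X × X)) :=
  fun p hp q hq h => Prod.ext h ((hf p hp q hq).1 h)

theorem IsPartialInj.injOn_snd {f : Finset (X × X)} (hf : IsPartialInj f) :
    Set.InjOn Prod.snd (f : Set (X × X)) :=
  fun p hp q hq h => Prod.ext ((hf p hp q hq).2 h) h

theorem mapDomain_apply_eq_zero {Y : Type w} {α : Type v'} {f : Set α} {Z : α →₀ k}
    (hZ : Z ∈ Finsupp.supported k k f) (m : α → Y) {y : Y} (hy : ∀ p ∈ f, m p ≠ y) :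
    Finsupp.mapDomain m Z y = 0 := by
  classical
  by_contra h
  have := Finsupp.mapDomain_support (Finsupp.mem_support_iff.2 h)
  obtain ⟨p, hp, rfl⟩ := Finset.mem_image.1 this
  exact hy p (hZ hp) rfl

theorem card_support_mapDomain {Y : Type w} {α : Type v'} {f : Set α} {Z : α →₀ k}
    (hZ : Z ∈ Finsupp.supported k k f) {m : α → Y} (hm : Set.InjOn m f) :
    (Finsupp.mapDomain m Z).support.card = Z.support.card := by
  classical
  rw [Finsupp.mapDomain_support_of_injOn Z (hm.mono hZ), Finset.card_image_of_injOn (hm.mono hZ)]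

theorem eq_zero_of_mapDomain_eq_zero {Y : Type w} {α : Type v'} {f : Set α} {Z : α →₀ k}
    (hZ : Z ∈ Finsupp.supported k k f) {m : α → Y} (hm : Set.InjOn m f)
    (h : Finsupp.mapDomain m Z = 0) : Z = 0 := by
  have := card_support_mapDomain hZ hm
  rw [h] at this
  simpa using this.symm

theorem exists_supported_insert [DecidableEq X] {f : Finset (X × X)} {a : X × X}
    {Z : X × X →₀ k} (hZ : Z ∈ Finsupp.supported k k (↑(insert a f) : Set (X × X))) :
    ∃ Z₀ ∈ Finsupp.supported k k (f : Set (X × X)), ∃ c, Z = Z₀ + Finsupp.single a c := by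
  refine ⟨Z.erase a, fun p hp => ?_, Z a, by rw [add_comm, Finsupp.single_add_erase]⟩
  rw [Finset.mem_coe, Finsupp.support_erase, Finset.mem_erase] at hp
  simpa [hp.1] using hZ hp.2

theorem GraphClosed.image_swap [DecidableEq X] {f : Finset (X × X)} {S : Submodule k (X →₀ k)}
    (h : GraphClosed f S) : GraphClosed (f.image Prod.swap) S := by
  intro Z hZ
  have := h (Finsupp.mapDomain Prod.swap Z) fun p hp => by
    obtain ⟨q, hq, rfl⟩ := Finset.mem_image.1 (Finsupp.mapDomain_support hp)
    obtain ⟨a, ha, rfl⟩ := Finset.mem_image.1 (hZ hq)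
    simpa using ha
  rw [← Finsupp.mapDomain_comp, ← Finsupp.mapDomain_comp] at this
  exact this.symm

/-- The one-step extension of the no-monomial property: a partial map from the family is extended by
one pair whose second entry is not touched by the family. -/
theorem exists_closed_noMonomial_insert [DecidableEq X] {F : Set (Finset (X × X))}
    {f : Finset (X × X)} (hf : f ∈ F) {x y : X} (hxy : x ≠ y)
    (hfresh : ∀ g ∈ F, ∀ p ∈ g, p.1 ≠ y ∧ p.2 ≠ y) (hinj : ∀ g ∈ F, IsPartialInj g)
    (hinj' : IsPartialInj (insert (x, y) f))
    (hS : ∀ v : X →₀ k, 2 ≤ v.support.card →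
      ∃ S, v ∈ S ∧ NoMonomial S ∧ ∀ g ∈ F, GraphClosed g S)
    (v : X →₀ k) (hv : 2 ≤ v.support.card) :
    ∃ S, v ∈ S ∧ NoMonomial S ∧ (∀ g ∈ F, GraphClosed g S) ∧ GraphClosed (insert (x, y) f) S := by
  have fst_y : ∀ g ∈ F, ∀ Z ∈ Finsupp.supported k k (g : Set (X × X)),
      Finsupp.mapDomain Prod.fst Z y = 0 := fun g hg Z hZ =>
    mapDomain_apply_eq_zero hZ _ fun p hp => (hfresh g hg p hp).1
  have snd_y : ∀ g ∈ F, ∀ Z ∈ Finsupp.supported k k (g : Set (X × X)),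
      Finsupp.mapDomain Prod.snd Z y = 0 := fun g hg Z hZ =>
    mapDomain_apply_eq_zero hZ _ fun p hp => (hfresh g hg p hp).2
  have fst_y' : ∀ Z ∈ Finsupp.supported k k (↑(insert (x, y) f) : Set (X × X)),
      Finsupp.mapDomain Prod.fst Z y = 0 := fun Z hZ =>
    mapDomain_apply_eq_zero hZ _ fun p hp => by
      rcases Finset.mem_insert.1 hp with rfl | hp
      · exact hxy
      · exact (hfresh f hf p hp).1
  have main : ∀ v : X →₀ k, 2 ≤ v.support.card → v y = 0 →
      ∃ S, v ∈ S ∧ NoMonomial S ∧ (∀ g ∈ F, GraphClosed g S) ∧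
        GraphClosed (insert (x, y) f) S := by
    intro v hv hvy
    obtain ⟨S₀, hvS₀, hmono₀, hcl₀⟩ := hS v hv
    -- No map in `F` touches y, so restricting to vectors with zero y-coordinate keeps closure under
    -- `F`.
    let S : Submodule k (X →₀ k) := S₀ ⊓ LinearMap.ker (Finsupp.lapply y)
    have hS_y : ∀ w ∈ S, w y = 0 := fun w hw => hw.2
    have hvS : v ∈ S := ⟨hvS₀, hvy⟩
    have hmono : NoMonomial S := fun a c h => hmono₀ a c h.1
    have hcl : ∀ g ∈ F, GraphClosed g S := fun g hg Z hZ =>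
      ⟨fun h => ⟨(hcl₀ g hg Z hZ).1 h.1, snd_y g hg Z hZ⟩,
        fun h => ⟨(hcl₀ g hg Z hZ).2 h.1, fst_y g hg Z hZ⟩⟩
    let T : Submodule k (X × X →₀ k) :=
      Finsupp.supported k k (↑(insert (x, y) f) : Set (X × X)) ⊓
        S.comap (Finsupp.lmapDomain k k Prod.fst)
    -- The free extension: add only the images, under the enlarged map, of vectors in `S`.
    let S' : Submodule k (X →₀ k) := S ⊔ T.map (Finsupp.lmapDomain k k Prod.snd)
    have hSS' : S ≤ S' := le_sup_left
    have hdecomp : ∀ t ∈ S', ∃ w ∈ S, ∃ Z₀ ∈ Finsupp.supported k k (f : Set (X × X)), ∃ c : k,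
        t = w + Finsupp.mapDomain Prod.snd Z₀ + Finsupp.single y c ∧
        Finsupp.mapDomain Prod.fst Z₀ + Finsupp.single x c ∈ S := by
      intro t ht
      obtain ⟨w, hw, _, ⟨Z, hZ, rfl⟩, rfl⟩ := Submodule.mem_sup.1 ht
      obtain ⟨Z₀, hZ₀, c, hZeq⟩ := exists_supported_insert hZ.1
      refine ⟨w, hw, Z₀, hZ₀, c, ?_, ?_⟩
      · conv_lhs => rw [hZeq]
        simp [Finsupp.mapDomain_add, Finsupp.mapDomain_single, add_assoc]
      · have : Finsupp.mapDomain Prod.fst Z ∈ S := hZ.2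
        rw [hZeq] at this
        simpa [Finsupp.mapDomain_add, Finsupp.mapDomain_single] using this
    -- Conservativity: since y is fresh, the enlargement adds no vector with zero y-coordinate.
    have hback : ∀ t ∈ S', t y = 0 → t ∈ S := by
      intro t ht hty
      obtain ⟨w, hw, Z₀, hZ₀, c, rfl, hc⟩ := hdecomp t ht
      have : c = 0 := by simpa [hS_y w hw, snd_y f hf Z₀ hZ₀] using hty
      subst this
      simp only [Finsupp.single_zero, add_zero] at hc ⊢
      exact S.add_mem hw ((hcl f hf Z₀ hZ₀).1 hc)
    refine ⟨S', hSS' hvS, ?_, fun g hg Z hZ => ?_, fun Z hZ => ⟨fun h => ?_, fun h => ?_⟩⟩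
    · intro a c ha
      by_cases hay : a = y
      · subst hay
        obtain ⟨w, hw, Z₀, hZ₀, c', heq, hc'⟩ := hdecomp _ ha
        have hcc : c = c' := by
          have := DFunLike.congr_fun heq a
          simpa [hS_y w hw, snd_y f hf Z₀ hZ₀] using this
        subst hcc
        have h0 : w + Finsupp.mapDomain Prod.snd Z₀ = 0 := by
          simpa using heq.symm
        have h1 : Finsupp.mapDomain Prod.snd Z₀ ∈ S := by
          rw [eq_neg_of_add_eq_zero_right h0]; exact S.neg_mem hw
        exact hmono x c ((S.add_mem_iff_right ((hcl f hf Z₀ hZ₀).2 h1)).1 hc')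
      · exact hmono a c (hback _ ha (by simp [hay]))
    · exact ⟨fun h => hSS' ((hcl g hg Z hZ).1 (hback _ h (fst_y g hg Z hZ))),
        fun h => hSS' ((hcl g hg Z hZ).2 (hback _ h (snd_y g hg Z hZ)))⟩
    · exact Submodule.mem_sup_right ⟨Z, ⟨hZ, hback _ h (fst_y' Z hZ)⟩, rfl⟩
    · obtain ⟨w, hw, _, ⟨Z', hZ', rfl⟩, heq⟩ := Submodule.mem_sup.1 h
      have hdiff : Finsupp.mapDomain Prod.snd (Z - Z') = w := by
        have := map_sub (Finsupp.lmapDomain k k (Prod.snd : X × X → X)) Z Z'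
        simp only [Finsupp.lmapDomain_apply] at this heq
        rw [this, ← heq, add_sub_cancel_right]
      have hsup : Z - Z' ∈ Finsupp.supported k k (↑(insert (x, y) f) : Set (X × X)) :=
        Submodule.sub_mem _ hZ hZ'.1
      obtain ⟨Z₀, hZ₀, c, hZeq⟩ := exists_supported_insert hsup
      have hc0 : c = 0 := by
        have h1 := hS_y w hw
        rw [← hdiff, hZeq] at h1
        simpa [Finsupp.mapDomain_add, Finsupp.mapDomain_single, snd_y f hf Z₀ hZ₀] using h1
      rw [hc0, Finsupp.single_zero, add_zero] at hZeq
      have h2 : Finsupp.mapDomain Prod.fst (Z - Z') ∈ S := by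
        rw [hZeq]
        refine (hcl f hf Z₀ hZ₀).2 ?_
        rw [← hZeq, hdiff]
        exact hw
      have h3 : Finsupp.mapDomain Prod.fst Z ∈ S := by
        have h4 : Finsupp.mapDomain Prod.fst Z' ∈ S := hZ'.2
        have := map_sub (Finsupp.lmapDomain k k (Prod.fst : X × X → X)) Z Z'
        simp only [Finsupp.lmapDomain_apply] at this
        rw [this] at h2
        exact (S.sub_mem_iff_left h4).1 h2
      exact hSS' h3
  by_cases hvy : v y = 0
  · exact main v hv hvy
  -- If v is an image under the enlarged map, its preimage has zero y-coordinate and the same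
  -- support size, so the first case applies to it. Otherwise the line through v works: its nonzero
  -- vectors lie in no domain or range, so closure is vacuous.
  by_cases hex : ∃ Z ∈ Finsupp.supported k k (↑(insert (x, y) f) : Set (X × X)),
      Finsupp.mapDomain Prod.snd Z = v
  · obtain ⟨Z, hZ, rfl⟩ := hex
    rw [card_support_mapDomain hZ hinj'.injOn_snd] at hv
    obtain ⟨S, h1, h2, h3, h4⟩ := main (Finsupp.mapDomain Prod.fst Z)
      (by rwa [card_support_mapDomain hZ hinj'.injOn_fst]) (fst_y' Z hZ)
    exact ⟨S, (h4 Z hZ).1 h1, h2, h3, h4⟩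
  · have hzero : ∀ w ∈ k ∙ v, w y = 0 → w = 0 := by
      intro w hw hwy
      obtain ⟨c, rfl⟩ := Submodule.mem_span_singleton.1 hw
      rcases mul_eq_zero.1 (by simpa using hwy : c * v y = 0) with h | h
      · simp [h]
      · exact absurd h hvy
    refine ⟨k ∙ v, Submodule.mem_span_singleton_self v, ?_, fun g hg Z hZ => ⟨fun h => ?_, fun h => ?_⟩,
      fun Z hZ => ⟨fun h => ?_, fun h => ?_⟩⟩
    · intro a c ha
      obtain ⟨b, hb⟩ := Submodule.mem_span_singleton.1 ha
      by_contra hc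
      have hb0 : b ≠ 0 := by
        rintro rfl
        simp only [zero_smul] at hb
        exact hc (by simpa using hb.symm)
      have : v.support = (Finsupp.single a c).support := by
        rw [← hb, Finsupp.support_smul_eq hb0]
      rw [this, Finsupp.support_single _ hc] at hv
      simp at hv
    · rw [eq_zero_of_mapDomain_eq_zero hZ (hinj g hg).injOn_fst (hzero _ h (fst_y g hg Z hZ))]
      simp
    · rw [eq_zero_of_mapDomain_eq_zero hZ (hinj g hg).injOn_snd (hzero _ h (snd_y g hg Z hZ))]
      simp
    · rw [eq_zero_of_mapDomain_eq_zero hZ hinj'.injOn_fst (hzero _ h (fst_y' Z hZ))]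
      simp
    · obtain ⟨b, hb⟩ := Submodule.mem_span_singleton.1 h
      by_cases hb0 : b = 0
      · rw [hb0, zero_smul] at hb
        rw [eq_zero_of_mapDomain_eq_zero hZ hinj'.injOn_snd hb.symm]
        simp
      · refine absurd ⟨b⁻¹ • Z, Submodule.smul_mem _ _ hZ, ?_⟩ hex
        rw [Finsupp.mapDomain_smul, ← hb, smul_smul, inv_mul_cancel₀ hb0, one_smul]

end PartialMaps

/-! ### Rich families of finite partial injections -/

section Family

variable {k : Type u} [Field k] {κ : Type v} {Λ : Type u'} {Y : Type v'}

/-- A finite partial injection of `κ × ℕ` which preserves the labels `ℓ` and all the equivalence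
relations `pr j a = pr j b`. -/
structure Admissible (ℓ : κ → Λ) (pr : ℕ → κ → Y) (f : Finset ((κ × ℕ) × (κ × ℕ))) : Prop where
  inj : IsPartialInj f
  label : ∀ p ∈ f, ℓ p.1.1 = ℓ p.2.1
  proj : ∀ j, ∀ p ∈ f, ∀ q ∈ f, pr j p.1.1 = pr j q.1.1 ↔ pr j p.2.1 = pr j q.2.1

theorem Admissible.image_swap [DecidableEq κ] {ℓ : κ → Λ} {pr : ℕ → κ → Y}
    {f : Finset ((κ × ℕ) × (κ × ℕ))} (h : Admissible ℓ pr f) :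
    Admissible ℓ pr (f.image Prod.swap) := by
  refine ⟨?_, ?_, ?_⟩
  · intro p hp q hq
    obtain ⟨a, ha, rfl⟩ := Finset.mem_image.1 hp
    obtain ⟨b, hb, rfl⟩ := Finset.mem_image.1 hq
    exact (h.inj a ha b hb).symm
  · intro p hp
    obtain ⟨a, ha, rfl⟩ := Finset.mem_image.1 hp
    exact (h.label a ha).symm
  · intro j p hp q hq
    obtain ⟨a, ha, rfl⟩ := Finset.mem_image.1 hp
    obtain ⟨b, hb, rfl⟩ := Finset.mem_image.1 hq
    exact (h.proj j a ha b hb).symm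

/-- The stages of the construction of a family of partial injections: at each step at most one map of
the family is extended, by one pair whose second entry is new. -/
def familyStage [DecidableEq κ] (ℓ : κ → Λ) (pr : ℕ → κ → Y)
    (task : ℕ → Finset ((κ × ℕ) × (κ × ℕ)) × (κ × ℕ) × κ) : ℕ → Set (Finset ((κ × ℕ) × (κ × ℕ)))
  | 0 => {∅}
  | t + 1 => familyStage ℓ pr task t ∪
      {g | (task t).1 ∈ familyStage ℓ pr task t ∧ (task t).2.1.2 < t ∧
        Admissible ℓ pr (insert ((task t).2.1, ((task t).2.2, t)) (task t).1) ∧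
        (g = insert ((task t).2.1, ((task t).2.2, t)) (task t).1 ∨
          g = (insert ((task t).2.1, ((task t).2.2, t)) (task t).1).image Prod.swap)}

theorem Finset.image_swap_image_swap {α : Type*} [DecidableEq α] (f : Finset (α × α)) :
    (f.image Prod.swap).image Prod.swap = f := by
  simp [Finset.image_image]

section

variable [DecidableEq κ] (ℓ : κ → Λ) (pr : ℕ → κ → Y) (task : ℕ → Finset ((κ × ℕ) × (κ × ℕ)) × (κ × ℕ) × κ)

theorem familyStage_mono : Monotone (familyStage ℓ pr task) :=
  monotone_nat_of_le_succ fun _ => Set.subset_union_left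

theorem familyStage_lt (t : ℕ) : ∀ f ∈ familyStage ℓ pr task t, ∀ p ∈ f, p.1.2 < t ∧ p.2.2 < t := by
  induction t with
  | zero => intro f hf; simp [Set.mem_singleton_iff.1 hf]
  | succ t ih =>
    rintro f (hf | ⟨h1, h2, h3, h4⟩) p hp
    · exact ⟨(ih f hf p hp).1.trans t.lt_succ_self, (ih f hf p hp).2.trans t.lt_succ_self⟩
    · have key : ∀ p ∈ insert ((task t).2.1, ((task t).2.2, t)) (task t).1,
          p.1.2 < t + 1 ∧ p.2.2 < t + 1 := by
        intro p hp
        rcases Finset.mem_insert.1 hp with rfl | hp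
        · exact ⟨h2.trans t.lt_succ_self, t.lt_succ_self⟩
        · exact ⟨(ih _ h1 p hp).1.trans t.lt_succ_self, (ih _ h1 p hp).2.trans t.lt_succ_self⟩
      rcases h4 with rfl | rfl
      · exact key p hp
      · obtain ⟨q, hq, rfl⟩ := Finset.mem_image.1 hp
        exact (key q hq).symm

theorem familyStage_admissible (t : ℕ) : ∀ f ∈ familyStage ℓ pr task t, Admissible ℓ pr f := by
  induction t with
  | zero =>
    intro f hf
    rw [Set.mem_singleton_iff.1 hf]
    exact ⟨by simp [IsPartialInj], by simp, by simp⟩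
  | succ t ih =>
    rintro f (hf | ⟨-, -, h3, rfl | rfl⟩)
    · exact ih f hf
    · exact h3
    · exact h3.image_swap

theorem familyStage_image_swap (t : ℕ) :
    ∀ f ∈ familyStage ℓ pr task t, f.image Prod.swap ∈ familyStage ℓ pr task t := by
  induction t with
  | zero =>
    intro f hf
    rw [Set.mem_singleton_iff.1 hf]
    simp [familyStage]
  | succ t ih =>
    rintro f (hf | ⟨h1, h2, h3, rfl | rfl⟩)
    · exact Or.inl (ih f hf)
    · exact Or.inr ⟨h1, h2, h3, Or.inr rfl⟩
    · refine Or.inr ⟨h1, h2, h3, Or.inl ?_⟩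
      exact Finset.image_swap_image_swap _

theorem familyStage_noMonomial (t : ℕ) (v : κ × ℕ →₀ k) (hv : 2 ≤ v.support.card) :
    ∃ S, v ∈ S ∧ NoMonomial S ∧ ∀ g ∈ familyStage ℓ pr task t, GraphClosed g S := by
  induction t generalizing v with
  | zero =>
    refine ⟨k ∙ v, Submodule.mem_span_singleton_self v, fun a c ha => ?_, fun g hg Z hZ => ?_⟩
    · obtain ⟨b, hb⟩ := Submodule.mem_span_singleton.1 ha
      by_contra hc
      have hb0 : b ≠ 0 := by
        rintro rfl
        simp only [zero_smul] at hb
        exact hc (by simpa using hb.symm)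
      have : v.support = (Finsupp.single a c).support := by
        rw [← hb, Finsupp.support_smul_eq hb0]
      rw [this, Finsupp.support_single _ hc] at hv
      simp at hv
    · have : Z = 0 := by
        rw [Set.mem_singleton_iff.1 hg] at hZ
        simpa using hZ
      simp [this]
  | succ t ih =>
    by_cases h : (task t).1 ∈ familyStage ℓ pr task t ∧ (task t).2.1.2 < t ∧
        Admissible ℓ pr (insert ((task t).2.1, ((task t).2.2, t)) (task t).1)
    · obtain ⟨h1, h2, h3⟩ := h
      obtain ⟨S, hS1, hS2, hS3, hS4⟩ := exists_closed_noMonomial_insert h1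
        (x := (task t).2.1) (y := ((task t).2.2, t))
        (fun hxy => h2.ne (congrArg Prod.snd hxy))
        (fun g hg p hp => ⟨fun hpy => (familyStage_lt ℓ pr task t g hg p hp).1.ne
            (congrArg Prod.snd hpy), fun hpy => (familyStage_lt ℓ pr task t g hg p hp).2.ne
            (congrArg Prod.snd hpy)⟩)
        (fun g hg => (familyStage_admissible ℓ pr task t g hg).inj) h3.inj ih v hv
      refine ⟨S, hS1, hS2, ?_⟩
      rintro g (hg | ⟨-, -, -, rfl | rfl⟩)
      · exact hS3 g hg
      · exact hS4
      · exact hS4.image_swap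
    · obtain ⟨S, hS1, hS2, hS3⟩ := ih v hv
      refine ⟨S, hS1, hS2, ?_⟩
      rintro g (hg | ⟨h1, h2, h3, -⟩)
      · exact hS3 g hg
      · exact absurd ⟨h1, h2, h3⟩ h

end

/-- A rich family of partial injections of `κ × ℕ` for which every vector with at least two nonzero
coordinates lies in an invariant subspace without monomials. -/
structure RichFamily (k : Type u) [Field k] [DecidableEq κ] (ℓ : κ → Λ) (pr : ℕ → κ → Y) where
  maps : Set (Finset ((κ × ℕ) × (κ × ℕ)))
  empty_mem : ∅ ∈ maps
  adm : ∀ f ∈ maps, Admissible ℓ pr f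
  swap_mem : ∀ f ∈ maps, f.image Prod.swap ∈ maps
  extend : ∀ f ∈ maps, ∀ x : κ × ℕ, ∀ c : κ, (∀ p ∈ f, p.1 ≠ x) → ℓ x.1 = ℓ c →
    (∀ j, ∀ p ∈ f, pr j x.1 = pr j p.1.1 ↔ pr j c = pr j p.2.1) →
    ∃ n, insert (x, (c, n)) f ∈ maps
  closed : ∀ v : κ × ℕ →₀ k, 2 ≤ v.support.card →
    ∃ S, v ∈ S ∧ NoMonomial S ∧ ∀ g ∈ maps, GraphClosed g S

theorem exists_surjective_infinitely_often (α : Type*) [Countable α] [Nonempty α] :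
    ∃ g : ℕ → α, ∀ a n, ∃ m, n ≤ m ∧ g m = a := by
  obtain ⟨e, he⟩ := exists_surjective_nat α
  refine ⟨fun m => e m.unpair.1, fun a n => ?_⟩
  obtain ⟨i, rfl⟩ := he a
  exact ⟨Nat.pair i n, Nat.right_le_pair i n, by simp⟩

theorem RichFamily.nonempty (k : Type u) [Field k] [DecidableEq κ] [Countable κ] [Nonempty κ]
    (ℓ : κ → Λ) (pr : ℕ → κ → Y) : Nonempty (RichFamily k ℓ pr) := by
  obtain ⟨task, htask⟩ := exists_surjective_infinitely_often
    (Finset ((κ × ℕ) × (κ × ℕ)) × (κ × ℕ) × κ)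
  refine ⟨{ maps := ⋃ t, familyStage ℓ pr task t, empty_mem := ?_, adm := ?_, swap_mem := ?_,
            extend := ?_, closed := ?_ }⟩
  · exact Set.mem_iUnion.2 ⟨0, rfl⟩
  · intro f hf
    obtain ⟨t, ht⟩ := Set.mem_iUnion.1 hf
    exact familyStage_admissible ℓ pr task t f ht
  · intro f hf
    obtain ⟨t, ht⟩ := Set.mem_iUnion.1 hf
    exact Set.mem_iUnion.2 ⟨t, familyStage_image_swap ℓ pr task t f ht⟩
  · intro f hf x c hx hlab hpr
    obtain ⟨t, ht⟩ := Set.mem_iUnion.1 hf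
    -- The task recurs at a stage m where f is already present and m exceeds the index of x; then
    -- (c, m) is fresh.
    obtain ⟨m, hm, hmt⟩ := htask (f, x, c) (max t (x.2 + 1))
    have hfm := familyStage_mono ℓ pr task ((le_max_left _ _).trans hm) ht
    have hxm : x.2 < m := (le_max_right t _).trans hm
    have hadm := familyStage_admissible ℓ pr task t f ht
    refine ⟨m, Set.mem_iUnion.2 ⟨m + 1, Or.inr ?_⟩⟩
    simp only [hmt, Set.mem_ofPred_eq]
    refine ⟨hfm, hxm, ⟨?_, ?_, ?_⟩, Or.inl trivial⟩
    · intro p hp q hq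
      have hfresh := familyStage_lt ℓ pr task m f hfm
      rcases Finset.mem_insert.1 hp with rfl | hp' <;> rcases Finset.mem_insert.1 hq with rfl | hq'
      · simp
      · refine iff_of_false (fun h => hx q hq' h.symm) fun h => (hfresh q hq').2.ne ?_
        rw [← h]
      · refine iff_of_false (fun h => hx p hp' h) fun h => (hfresh p hp').2.ne ?_
        rw [h]
      · exact hadm.inj p hp' q hq'
    · intro p hp
      rcases Finset.mem_insert.1 hp with rfl | hp'
      · exact hlab
      · exact hadm.label p hp'
    · intro j p hp q hq
      rcases Finset.mem_insert.1 hp with rfl | hp' <;> rcases Finset.mem_insert.1 hq with rfl | hq'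
      · simp
      · exact hpr j q hq'
      · rw [eq_comm, hpr j p hp', eq_comm]
      · exact hadm.proj j p hp' q hq'
  · intro v hv
    -- The least subspace containing v and closed under stage t. Minimality makes these increase
    -- with t, and each lies in a monomial-free subspace, so their union is monomial-free and closed
    -- under all stages.
    let T : ℕ → Submodule k (κ × ℕ →₀ k) := fun t =>
      sInf {S | v ∈ S ∧ ∀ g ∈ familyStage ℓ pr task t, GraphClosed g S}
    have hTmono : Monotone T := fun s t hst => sInf_le_sInf fun S hS =>
      ⟨hS.1, fun g hg => hS.2 g (familyStage_mono ℓ pr task hst hg)⟩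
    have hTcl : ∀ t, ∀ g ∈ familyStage ℓ pr task t, GraphClosed g (T t) := by
      intro t g hg Z hZ
      simp only [T, Submodule.mem_sInf]
      exact forall₂_congr fun S hS => hS.2 g hg Z hZ
    have hdir : Directed (· ≤ ·) T := hTmono.directed_le
    refine ⟨⨆ t, T t, ?_, fun a c ha => ?_, fun g hg Z hZ => ?_⟩
    · exact Submodule.mem_iSup_of_mem 0 ((Submodule.mem_sInf).2 fun S hS => hS.1)
    · obtain ⟨t, ht⟩ := (Submodule.mem_iSup_of_directed T hdir).1 ha
      obtain ⟨S, hS1, hS2, hS3⟩ := familyStage_noMonomial (k := k) ℓ pr task t v hv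
      exact hS2 a c ((sInf_le ⟨hS1, hS3⟩ : T t ≤ S) ht)
    · obtain ⟨t₀, ht₀⟩ := Set.mem_iUnion.1 hg
      simp only [Submodule.mem_iSup_of_directed T hdir]
      constructor
      · rintro ⟨t, ht⟩
        exact ⟨max t₀ t, (hTcl _ g (familyStage_mono ℓ pr task (le_max_left _ _) ht₀) Z hZ).1
          (hTmono (le_max_right _ _) ht)⟩
      · rintro ⟨t, ht⟩
        exact ⟨max t₀ t, (hTcl _ g (familyStage_mono ℓ pr task (le_max_left _ _) ht₀) Z hZ).2
          (hTmono (le_max_right _ _) ht)⟩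

end Family

/-! ### Lifting permutations by back and forth -/

section BackAndForth

variable {k : Type u} [Field k] {κ : Type v} {Λ : Type u'} {Y : Type v'} [DecidableEq κ]
  {ℓ : κ → Λ} {pr : ℕ → κ → Y} (𝓕 : RichFamily k ℓ pr)

/-- A permutation of `κ` which preserves the labels and the equivalence relations lifts to a
permutation of `κ × ℕ` under which all invariant subspaces are invariant. -/
theorem RichFamily.exists_perm [Countable κ] (g : κ ≃ κ) (hℓ : ∀ a, ℓ (g a) = ℓ a)
    (hpr : ∀ j a b, pr j a = pr j b ↔ pr j (g a) = pr j (g b)) :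
    ∃ e : (κ × ℕ) ≃ (κ × ℕ), (∀ x, (e x).1 = g x.1) ∧
      ∀ S : Submodule k (κ × ℕ →₀ k), (∀ f ∈ 𝓕.maps, GraphClosed f S) →
        ∀ z, z ∈ S ↔ Finsupp.mapDomain e z ∈ S := by
  let P := {f : Finset ((κ × ℕ) × (κ × ℕ)) // f ∈ 𝓕.maps ∧ ∀ p ∈ f, p.2.1 = g p.1.1}
  have forth : ∀ (g : κ ≃ κ), (∀ a, ℓ (g a) = ℓ a) →
      (∀ j a b, pr j a = pr j b ↔ pr j (g a) = pr j (g b)) → ∀ f ∈ 𝓕.maps,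
      (∀ p ∈ f, p.2.1 = g p.1.1) → ∀ x, ∃ f' ∈ 𝓕.maps, (∀ p ∈ f', p.2.1 = g p.1.1) ∧ f ⊆ f' ∧
        ∃ y, (x, y) ∈ f' := by
    intro g hℓ hpr f hf hfg x
    by_cases hx : ∃ y, (x, y) ∈ f
    · exact ⟨f, hf, hfg, subset_rfl, hx⟩
    · obtain ⟨n, hn⟩ := 𝓕.extend f hf x (g x.1)
        (fun p hp hpx => hx ⟨p.2, by rw [← hpx]; exact hp⟩) (hℓ _).symm
        (fun j p hp => by rw [hfg p hp]; exact hpr j _ _)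
      refine ⟨_, hn, ?_, Finset.subset_insert _ _, _, Finset.mem_insert_self _ _⟩
      intro p hp
      rcases Finset.mem_insert.1 hp with rfl | hp
      · rfl
      · exact hfg p hp
  have : Encodable (κ × ℕ ⊕ κ × ℕ) := Encodable.ofCountable _
  let D : κ × ℕ ⊕ κ × ℕ → Order.Cofinal P := fun s => match s with
    | .inl x =>
      { carrier := {f | ∃ y, (x, y) ∈ f.1}
        isCofinal := by
          rintro ⟨f, hf, hfg⟩
          obtain ⟨f', h1, h2, h3, h4⟩ := forth g hℓ hpr f hf hfg x
          exact ⟨⟨f', h1, h2⟩, h4, h3⟩ }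
    | .inr y =>
      { carrier := {f | ∃ x, (x, y) ∈ f.1}
        isCofinal := by
          rintro ⟨f, hf, hfg⟩
          -- Surjectivity is totality for the inverse: extend the swapped map over `g.symm`, then
          -- swap back.
          have hsymm : ∀ f : Finset ((κ × ℕ) × (κ × ℕ)), ∀ g : κ ≃ κ,
              (∀ p ∈ f, p.2.1 = g p.1.1) → ∀ p ∈ f.image Prod.swap, p.2.1 = g.symm p.1.1 := by
            intro f g h p hp
            obtain ⟨q, hq, rfl⟩ := Finset.mem_image.1 hp
            simp [h q hq]
          obtain ⟨f', h1, h2, h3, x, h4⟩ := forth g.symm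
            (fun a => by rw [← hℓ, Equiv.apply_symm_apply])
            (fun j a b => by rw [hpr j (g.symm a)]; simp)
            (f.image Prod.swap) (𝓕.swap_mem f hf) (hsymm f g hfg) y
          refine ⟨⟨f'.image Prod.swap, 𝓕.swap_mem _ h1, hsymm f' g.symm h2⟩,
            ⟨x, Finset.mem_image.2 ⟨(y, x), h4, rfl⟩⟩, ?_⟩
          change f ⊆ f'.image Prod.swap
          rw [← Finset.image_swap_image_swap f]
          exact Finset.image_subset_image h3 }
  -- A directed set of maps over g that meets every condition; its union is the graph of the desired
  -- permutation.
  let I := Order.idealOfCofinals (⟨∅, 𝓕.empty_mem, by simp⟩ : P) D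
  have htot : ∀ x, ∃ y, ∃ f ∈ I, (x, y) ∈ f.1 := fun x => by
    obtain ⟨f, ⟨y, hy⟩, hf⟩ := Order.cofinal_meets_idealOfCofinals
      (⟨∅, 𝓕.empty_mem, by simp⟩ : P) D (.inl x)
    exact ⟨y, f, hf, hy⟩
  have hsurj : ∀ y, ∃ x, ∃ f ∈ I, (x, y) ∈ f.1 := fun y => by
    obtain ⟨f, ⟨x, hx⟩, hf⟩ := Order.cofinal_meets_idealOfCofinals
      (⟨∅, 𝓕.empty_mem, by simp⟩ : P) D (.inr y)
    exact ⟨x, f, hf, hx⟩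
  have huniq : ∀ x y x' y', (∃ f ∈ I, (x, y) ∈ f.1) → (∃ f ∈ I, (x', y') ∈ f.1) →
      (x = x' ↔ y = y') := by
    rintro x y x' y' ⟨f, hf, hxy⟩ ⟨f', hf', hxy'⟩
    obtain ⟨f'', -, h, h'⟩ := I.directed f hf f' hf'
    exact (𝓕.adm f'' f''.2.1).inj _ (h hxy) _ (h' hxy')
  choose e he using htot
  have hbij : Function.Bijective e := by
    refine ⟨fun x x' h => (huniq _ _ _ _ (he x) (he x')).2 h, fun y => ?_⟩
    obtain ⟨x, hx⟩ := hsurj y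
    exact ⟨x, (huniq _ _ _ _ (he x) hx).1 rfl⟩
  refine ⟨Equiv.ofBijective e hbij, fun x => ?_, fun S hS z => ?_⟩
  · obtain ⟨f, -, hf⟩ := he x
    exact f.2.2 _ hf
  -- A vector has finite support, so a single map of the ideal already acts on it as e does.
  · have hcover : ∀ s : Finset (κ × ℕ), ∃ f ∈ I, ∀ x ∈ s, (x, e x) ∈ f.1 := by
      intro s
      induction s using Finset.induction_on with
      | empty =>
        obtain ⟨f, hf⟩ := I.nonempty
        exact ⟨f, hf, by simp⟩
      | insert a s _ ih =>
        obtain ⟨f, hf, h⟩ := ih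
        obtain ⟨f', hf', h'⟩ := he a
        obtain ⟨f'', hf'', h1, h2⟩ := I.directed f hf f' hf'
        refine ⟨f'', hf'', fun x hx => ?_⟩
        rcases Finset.mem_insert.1 hx with rfl | hx
        · exact h2 h'
        · exact h1 (h x hx)
    obtain ⟨f, -, hf⟩ := hcover z.support
    have := hS f.1 f.2.1 (Finsupp.mapDomain (fun x => (x, e x)) z) fun p hp => by
      obtain ⟨x, hx, rfl⟩ := Finset.mem_image.1 (Finsupp.mapDomain_support hp)
      exact hf x hx
    rw [← Finsupp.mapDomain_comp, ← Finsupp.mapDomain_comp] at this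
    have hid : (Prod.fst ∘ fun x => (x, e x)) = id := rfl
    rw [hid, Finsupp.mapDomain_id] at this
    exact this

end BackAndForth

/-! ### Subspaces recording labels and entries -/

section Tags

variable {k : Type u} [Field k] {κ : Type v} {Λ : Type u'} {Y : Type v'}

/-- The kernel of the linear map induced by `pr j`. -/
noncomputable def projTag (k : Type u) [Field k] (pr : ℕ → κ → Y) (j : ℕ) :
    Submodule k (κ × ℕ →₀ k) :=
  LinearMap.ker (Finsupp.lmapDomain k k fun x : κ × ℕ => pr j x.1)

/-- The vectors whose image under the label map is concentrated at the label `c`. -/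
noncomputable def labelTag (k : Type u) [Field k] (ℓ : κ → Λ) (c : Λ) :
    Submodule k (κ × ℕ →₀ k) :=
  (Finsupp.supported k k {c}).comap (Finsupp.lmapDomain k k fun x : κ × ℕ => ℓ x.1)

/-- On f the map b factors through a, so pushing forward along b factors through pushing forward
along a. -/
theorem mapDomain_congr_fibers {α β γ : Type*} {f : Set α} {a : α → β} {b : α → γ}
    (h : ∀ p ∈ f, ∀ q ∈ f, a p = a q → b p = b q) {Z : α →₀ k}
    (hZ : Z ∈ Finsupp.supported k k f) (h0 : Finsupp.mapDomain a Z = 0) :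
    Finsupp.mapDomain b Z = 0 := by
  classical
  rcases isEmpty_or_nonempty α with hα | hα
  · rw [Subsingleton.elim Z 0, Finsupp.mapDomain_zero]
  · let φ : β → γ := fun y => if hy : ∃ p ∈ f, a p = y then b hy.choose else b (Classical.arbitrary α)
    have : Finsupp.mapDomain b Z = Finsupp.mapDomain (φ ∘ a) Z := by
      refine Finsupp.mapDomain_congr fun p hp => ?_
      have hp' : ∃ q ∈ f, a q = a p := ⟨p, hZ hp, rfl⟩
      simp only [φ, Function.comp, dif_pos hp']
      exact h _ (hZ hp) _ hp'.choose_spec.1 hp'.choose_spec.2.symm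
    rw [this, Finsupp.mapDomain_comp, h0, Finsupp.mapDomain_zero]

theorem Admissible.projTag_closed {ℓ : κ → Λ} {pr : ℕ → κ → Y} {f : Finset ((κ × ℕ) × (κ × ℕ))}
    (hf : Admissible ℓ pr f) (j : ℕ) : GraphClosed f (projTag k pr j) := by
  intro Z hZ
  simp only [projTag, LinearMap.mem_ker, Finsupp.lmapDomain_apply, ← Finsupp.mapDomain_comp]
  exact ⟨mapDomain_congr_fibers (fun p hp q hq => (hf.proj j p hp q hq).1) hZ,
    mapDomain_congr_fibers (fun p hp q hq => (hf.proj j p hp q hq).2) hZ⟩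

theorem Admissible.labelTag_closed {ℓ : κ → Λ} {pr : ℕ → κ → Y} {f : Finset ((κ × ℕ) × (κ × ℕ))}
    (hf : Admissible ℓ pr f) (c : Λ) : GraphClosed f (labelTag k ℓ c) := by
  intro Z hZ
  simp only [labelTag, Submodule.mem_comap, Finsupp.lmapDomain_apply, ← Finsupp.mapDomain_comp]
  have : Finsupp.mapDomain ((fun x : κ × ℕ => ℓ x.1) ∘ Prod.fst) Z =
      Finsupp.mapDomain ((fun x : κ × ℕ => ℓ x.1) ∘ Prod.snd) Z :=
    Finsupp.mapDomain_congr fun p hp => hf.label p (hZ hp)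
  rw [this]

theorem single_mem_labelTag {ℓ : κ → Λ} {c : Λ} {x : κ × ℕ} {a : k} (ha : a ≠ 0) :
    Finsupp.single x a ∈ labelTag k ℓ c ↔ ℓ x.1 = c := by
  simp only [labelTag, Submodule.mem_comap, Finsupp.lmapDomain_apply, Finsupp.mapDomain_single,
    Finsupp.mem_supported, Finsupp.support_single _ ha]
  simp

theorem eq_of_single_sub_mem_projTag {pr : ℕ → κ → Y} {j : ℕ} {x y : κ × ℕ} {a b : k} (ha : a ≠ 0)
    (h : Finsupp.single x a - Finsupp.single y b ∈ projTag k pr j) : pr j x.1 = pr j y.1 := by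
  simp only [projTag, LinearMap.mem_ker, map_sub, Finsupp.lmapDomain_apply,
    Finsupp.mapDomain_single, sub_eq_zero] at h
  rcases (Finsupp.single_eq_single_iff _ _ _ _).1 h with h | h
  · exact h.1
  · exact absurd h.1 ha

theorem single_sub_mem_projTag {pr : ℕ → κ → Y} {j : ℕ} {x y : κ × ℕ} (h : pr j x.1 = pr j y.1) :
    Finsupp.single x (1 : k) - Finsupp.single y 1 ∈ projTag k pr j := by
  rw [projTag, LinearMap.mem_ker, map_sub, Finsupp.lmapDomain_apply, Finsupp.lmapDomain_apply,
    Finsupp.mapDomain_single, Finsupp.mapDomain_single, h, sub_self]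

end Tags

/-! ## The modules attached to subsets of the index set -/

section TagModule

variable {R : Type u} [CommRing R] {ι : Type v} (G : GenericSystem R (ι × Bool))
  {k : Type u'} [Field k] [Algebra R k] {X : Type w} (U : ι → Submodule k (X →₀ k))

/-- Coordinatewise reduction from `R` to the residue field. -/
noncomputable def reduction (R : Type u) [CommRing R] (k : Type u') [Field k] [Algebra R k]
    (X : Type w) : (X →₀ R) →ₗ[R] (X →₀ k) :=
  Finsupp.mapRange.linearMap (Algebra.linearMap R k)

@[simp] theorem reduction_apply (f : X →₀ R) (x : X) :
    reduction R k X f x = algebraMap R k (f x) := rfl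

@[simp] theorem reduction_single (x : X) (a : R) :
    reduction R k X (Finsupp.single x a) = Finsupp.single x (algebraMap R k a) := by
  simp [reduction]

/-- The formal sums `f + ∑ γ_i u_i`. -/
abbrev FormalSum (R : Type u) [CommRing R] (ι : Type v) (X : Type w) :=
  (X →₀ R) × (ι × Bool →₀ (X →₀ R))

namespace GenericSystem

/-- The `n`-th approximation of a formal sum. -/
noncomputable def approx (n : ℕ) : FormalSum R ι X →ₗ[R] (X →₀ R) :=
  LinearMap.coprod LinearMap.id (Finsupp.lsum R fun i => G.s n i • LinearMap.id)

/-- The coefficients at `x` of the sum `∑ γ_i u_i`. -/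
noncomputable def coords (u : ι × Bool →₀ (X →₀ R)) (x : X) : ι × Bool →₀ R :=
  u.mapRange (fun z => z x) rfl

theorem approx_apply (n : ℕ) (ρ : FormalSum R ι X) (x : X) :
    G.approx n ρ x = ρ.1 x + Finsupp.linearCombination R (G.s n) (coords ρ.2 x) := by
  classical
  simp only [approx, LinearMap.coprod_apply, LinearMap.id_apply, Finsupp.add_apply, coords,
    Finsupp.linearCombination_apply]
  rw [Finsupp.sum_mapRange_index (by simp)]
  simp [Finsupp.lsum_apply, Finsupp.sum, Finsupp.finsetSum_apply, mul_comm]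

/-- The value of a formal sum in `∏ R / K_n`, at every coordinate. -/
noncomputable def value : FormalSum R ι X →ₗ[R] (X → ∀ n, R ⧸ G.K n) :=
  LinearMap.pi fun x => LinearMap.pi fun n =>
    (G.K n).mkQ.comp ((Finsupp.lapply x).comp (G.approx n))

theorem value_apply (ρ : FormalSum R ι X) (x : X) (n : ℕ) :
    G.value ρ x n = Ideal.Quotient.mk (G.K n) (G.approx n ρ x) := rfl

/-- The formal sums supported in `P` whose coefficients satisfy the conditions prescribed by `U`. -/
def tagSums (P : Set X) : Submodule R (FormalSum R ι X) where
  carrier := {ρ | ρ.1 ∈ Finsupp.supported R R P ∧ ∀ i, ρ.2 i ∈ Finsupp.supported R R P ∧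
    reduction R k X (ρ.2 i) ∈ U i.1}
  zero_mem' := ⟨Submodule.zero_mem _, fun i => ⟨Submodule.zero_mem _, by simp⟩⟩
  add_mem' := fun {a b} ha hb => ⟨Submodule.add_mem _ ha.1 hb.1, fun i =>
    ⟨Submodule.add_mem _ (ha.2 i).1 (hb.2 i).1, by
      simpa using (U i.1).add_mem (ha.2 i).2 (hb.2 i).2⟩⟩
  smul_mem' := fun c a ha => ⟨Submodule.smul_mem _ c ha.1, fun i =>
    ⟨Submodule.smul_mem _ c (ha.2 i).1, by
      simpa [algebraMap_smul] using (U i.1).smul_mem (algebraMap R k c) (ha.2 i).2⟩⟩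

/-- The module attached to the subset `P`. -/
noncomputable def tagModule (P : Set X) : Submodule R (X → ∀ n, R ⧸ G.K n) :=
  (tagSums U P).map G.value

/-- `m'` behaves like the product of `m` with the `i`-th limit coefficient. -/
def Scaled {M : Type*} [AddCommGroup M] [Module R M] (i : ι × Bool) (m m' : M) : Prop :=
  ∀ n a, (∀ y ∈ G.K n, a * y = 0) → a • m' = a • (G.s n i • m)

theorem Scaled.map {M N : Type*} [AddCommGroup M] [Module R M] [AddCommGroup N] [Module R N]
    {i : ι × Bool} {m m' : M} (h : G.Scaled i m m') (θ : M →ₗ[R] N) : G.Scaled i (θ m) (θ m') := by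
  intro n a ha
  rw [← map_smul, h n a ha, map_smul, map_smul]

/-- `Scaled` only controls multiples by a in the annihilator of K_n. Such an a does not distinguish
s_n from later approximations, so a times the value at s_n lies in all K_l and is zero; double
annihilation then removes a. -/
theorem eval_mem_of_scaled {i : ι × Bool} {ρ ρ' : FormalSum R ι X}
    (h : G.Scaled i (G.value ρ) (G.value ρ')) (x : X) (n : ℕ) :
    QuadDatum.eval ⟨i, ρ.1 x, ρ'.1 x, coords ρ.2 x, coords ρ'.2 x⟩ (G.s n) ∈ G.K n := by
  refine G.double_ann n _ fun a ha => G.inter _ fun l => ?_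
  have key : ∀ l, a * QuadDatum.eval ⟨i, ρ.1 x, ρ'.1 x, coords ρ.2 x, coords ρ'.2 x⟩ (G.s n) ∈
      G.K (max n l) := by
    intro l
    have h1 := congrFun (congrFun (h n a ha) x) (max n l)
    have hlin : ∀ u : ι × Bool →₀ R, a * Finsupp.linearCombination R (G.s (max n l)) u =
        a * Finsupp.linearCombination R (G.s n) u := by
      intro u
      rw [← sub_eq_zero, ← mul_sub]
      refine ha _ ?_
      have : Finsupp.linearCombination R (G.s (max n l)) u - Finsupp.linearCombination R (G.s n) u =
          Finsupp.linearCombination R (fun i => G.s (max n l) i - G.s n i) u := by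
        simp [Finsupp.linearCombination_apply, Finsupp.sum, mul_sub, Finset.sum_sub_distrib]
      rw [this]
      exact Finsupp.linearCombination_mem_ideal _ (fun j => G.s_sub_mem (le_max_left _ _) j) u
    have h2 : a * G.approx (max n l) ρ' x - a * (G.s n i * G.approx (max n l) ρ x) ∈
        G.K (max n l) := by
      rw [← Ideal.Quotient.mk_eq_mk_iff_sub_mem]
      exact h1
    rw [approx_apply, approx_apply] at h2
    convert h2 using 1
    simp only [QuadDatum.eval]
    linear_combination G.s n i * hlin (coords ρ.2 x) - hlin (coords ρ'.2 x)
  exact G.anti (le_max_right n l) (key l)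

theorem scaled_value (z : X →₀ R) (i : ι × Bool) :
    G.Scaled i (G.value (z, 0)) (G.value (0, Finsupp.single i z)) := by
  intro n a ha
  ext x l
  change Ideal.Quotient.mk (G.K l) (a * G.approx l (0, Finsupp.single i z) x) =
    Ideal.Quotient.mk (G.K l) (a * (G.s n i * G.approx l (z, 0) x))
  rw [Ideal.Quotient.mk_eq_mk_iff_sub_mem, approx_apply, approx_apply]
  simp only [coords, Finsupp.coe_zero, Pi.zero_apply, Finsupp.mapRange_single,
    Finsupp.linearCombination_single, Finsupp.mapRange_zero, map_zero, add_zero, zero_add,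
    smul_eq_mul]
  rcases le_total n l with h | h
  · have := ha _ (G.s_sub_mem h i)
    have : a * (z x * G.s l i) - a * (G.s n i * z x) = 0 := by linear_combination z x * this
    rw [this]
    exact Ideal.zero_mem _
  · have := (G.K l).mul_mem_left (-(a * z x)) (G.s_sub_mem h i)
    convert this using 1
    ring

/-- Makes the reduction of f + ∑ γ_j u_j well defined: by genericity, a linear relation among the
γ_j has its constant term in J. -/
theorem reduction_eq_zero_of_value_eq_zero [Nonempty ι] (hJ : ∀ a ∈ G.J, algebraMap R k a = 0)
    {ρ : FormalSum R ι X}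
    (h : G.value ρ = 0) : reduction R k X ρ.1 = 0 := by
  ext x
  refine hJ _ (G.const_mem_of_linear _ (coords ρ.2 x) fun n => ?_)
  rw [← approx_apply, ← Ideal.Quotient.eq_zero_iff_mem, ← value_apply, h]
  rfl

theorem reduction_eq_of_value_eq [Nonempty ι] (hJ : ∀ a ∈ G.J, algebraMap R k a = 0)
    {ρ ρ' : FormalSum R ι X} (h : G.value ρ = G.value ρ') :
    reduction R k X ρ.1 = reduction R k X ρ'.1 := by
  have := G.reduction_eq_zero_of_value_eq_zero hJ (ρ := ρ + (-1 : R) • ρ') (by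
    rw [map_add, map_smul, h, neg_one_smul, add_neg_cancel])
  rw [Prod.fst_add, Prod.smul_fst, map_add, map_smul, neg_one_smul] at this
  exact add_neg_eq_zero.1 this

theorem reduction_eq_zero_of_scaled (hJ : ∀ a ∈ G.J, algebraMap R k a = 0)
    {i : ι × Bool} {ρ ρ' : FormalSum R ι X}
    (h : G.Scaled i (G.value ρ) (G.value ρ')) : reduction R k X ρ'.1 = 0 := by
  ext x
  exact hJ _ (G.const_mem_of_quad _ (G.eval_mem_of_scaled h x))

/-- If both products with the γ_(i,b) exist, comparing coefficients shows that f agrees modulo 𝔪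
with the coefficient of γ_(i,true) in the second product, which is constrained to lie in U_i. -/
theorem reduction_mem_of_scaled_pair (hJ : ∀ a ∈ G.J, algebraMap R k a = 0)
    {i : ι} {ρ ρ₁ ρ₂ : FormalSum R ι X} {P : Set X}
    (hρ₂ : ρ₂ ∈ tagSums U P)
    (h₁ : G.Scaled (i, false) (G.value ρ) (G.value ρ₁))
    (h₂ : G.Scaled (i, true) (G.value ρ) (G.value ρ₂)) : reduction R k X ρ.1 ∈ U i := by
  have : reduction R k X ρ.1 = reduction R k X (ρ₂.2 (i, true)) := by
    ext x
    have := hJ _ (G.sub_mem_of_quad_pair (by simp) _ _ _ _ _ _ (G.eval_mem_of_scaled h₁ x)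
      (G.eval_mem_of_scaled h₂ x))
    simpa [coords, sub_eq_zero] using this
  rw [this]
  exact (hρ₂.2 (i, true)).2

end GenericSystem

end TagModule

/-! ### What module isomorphisms preserve -/

section TagModuleIso

variable {R : Type u} [CommRing R] {ι : Type v} {G : GenericSystem R (ι × Bool)}
  {k : Type u'} [Field k] [Algebra R k] {X : Type w} {U : ι → Submodule k (X →₀ k)}

namespace GenericSystem

/-- The element of `tagModule` with a given formal sum. -/
noncomputable def mkTag {P : Set X} (ρ : FormalSum R ι X) (hρ : ρ ∈ tagSums U P) :
    G.tagModule U P :=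
  ⟨G.value ρ, Submodule.mem_map_of_mem hρ⟩

theorem exists_mkTag {P : Set X} (m : G.tagModule U P) :
    ∃ ρ, ∃ hρ : ρ ∈ tagSums U P, m = mkTag ρ hρ := by
  obtain ⟨_, ρ, hρ, rfl⟩ := m
  exact ⟨ρ, hρ, rfl⟩

theorem scaled_coe_iff {P : Set X} {i : ι × Bool} {m m' : G.tagModule U P} :
    G.Scaled i m m' ↔ G.Scaled i (m : X → ∀ n, R ⧸ G.K n) m' :=
  ⟨fun h => h.map G (G.tagModule U P).subtype, fun h n a ha => Subtype.ext (h n a ha)⟩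

theorem fst_mem_tagSums {P : Set X} {f : X →₀ R} (hf : f ∈ Finsupp.supported R R P) :
    ((f, 0) : FormalSum R ι X) ∈ tagSums U P :=
  ⟨hf, fun i => ⟨Submodule.zero_mem _, by simp⟩⟩

theorem single_mem_tagSums {P : Set X} {z : X →₀ R} (hz : z ∈ Finsupp.supported R R P)
    {i : ι × Bool} (hzU : reduction R k X z ∈ U i.1) :
    ((0, Finsupp.single i z) : FormalSum R ι X) ∈ tagSums U P := by
  classical
  refine ⟨Submodule.zero_mem _, fun j => ?_⟩
  by_cases h : i = j
  · subst h
    simpa using ⟨hz, hzU⟩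
  · simp [h]

/-- The reduction of the elements of `tagModule` to vectors over the residue field. -/
noncomputable def tagReduction [Nonempty ι] (hJ : ∀ a ∈ G.J, algebraMap R k a = 0) (P : Set X) :
    G.tagModule U P →ₗ[R] (X →₀ k) where
  toFun m := reduction R k X (exists_mkTag m).choose.1
  map_add' m m' := by
    have h : ∀ m : G.tagModule U P, G.value (exists_mkTag m).choose = m := fun m =>
      (congrArg Subtype.val (exists_mkTag m).choose_spec.choose_spec).symm
    rw [G.reduction_eq_of_value_eq hJ (ρ' := (exists_mkTag m).choose + (exists_mkTag m').choose)
      (by rw [map_add, h, h, h]; rfl), Prod.fst_add, map_add]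
  map_smul' c m := by
    have h : ∀ m : G.tagModule U P, G.value (exists_mkTag m).choose = m := fun m =>
      (congrArg Subtype.val (exists_mkTag m).choose_spec.choose_spec).symm
    rw [G.reduction_eq_of_value_eq hJ (ρ' := c • (exists_mkTag m).choose)
      (by rw [map_smul, h, h]; rfl), Prod.smul_fst, map_smul, RingHom.id_apply]

variable [Nonempty ι] (hJ : ∀ a ∈ G.J, algebraMap R k a = 0)

theorem tagReduction_mkTag {P : Set X} (ρ : FormalSum R ι X) (hρ : ρ ∈ tagSums U P) :
    tagReduction hJ P (mkTag (G := G) ρ hρ) = reduction R k X ρ.1 := by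
  have h := (exists_mkTag (mkTag (G := G) ρ hρ)).choose_spec.choose_spec
  exact G.reduction_eq_of_value_eq hJ (congrArg Subtype.val h).symm

theorem tagReduction_mem_supported {P : Set X} (m : G.tagModule U P) :
    tagReduction hJ P m ∈ Finsupp.supported k k P := by
  obtain ⟨ρ, hρ, rfl⟩ := exists_mkTag m
  rw [tagReduction_mkTag]
  intro x hx
  refine hρ.1 ?_
  simp only [Finset.mem_coe, Finsupp.mem_support_iff, reduction_apply] at hx ⊢
  exact fun h => hx (by rw [h, map_zero])

theorem exists_tagReduction_eq (hsurj : Function.Surjective (algebraMap R k)) {P : Set X} {v : X →₀ k}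
    (hv : v ∈ Finsupp.supported k k P) :
    ∃ f, f ∈ Finsupp.supported R R P ∧ reduction R k X f = v := by
  classical
  refine ⟨Finsupp.onFinset v.support (fun x => if v x = 0 then 0 else (hsurj (v x)).choose) ?_,
    ?_, ?_⟩
  · intro x hx
    by_contra h
    simp only [Finsupp.mem_support_iff, not_not] at h
    simp [h] at hx
  · exact (Finset.coe_subset.2 Finsupp.support_onFinset_subset).trans hv
  · ext x
    by_cases h : v x = 0
    · simp [h]
    · simp [h, (hsurj (v x)).choose_spec]

/-- The submodule generated by the multiples by elements of the kernel of `R → k`, and by the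
products with limit coefficients. -/
def scaledSpan (G : GenericSystem R (ι × Bool)) (k : Type u') [Field k] [Algebra R k] (M : Type*)
    [AddCommGroup M] [Module R M] : Submodule R M :=
  Submodule.span R ({m | ∃ a, ∃ m' : M, algebraMap R k a = 0 ∧ m = a • m'} ∪
    {m | ∃ i, ∃ m' : M, G.Scaled i m' m})

omit [Nonempty ι] in
theorem scaledSpan_le_comap {M N : Type*} [AddCommGroup M] [Module R M] [AddCommGroup N]
    [Module R N] (θ : M →ₗ[R] N) : G.scaledSpan k M ≤ (G.scaledSpan k N).comap θ := by
  refine Submodule.span_le.2 ?_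
  rintro _ (⟨a, m, ha, rfl⟩ | ⟨i, m', h⟩)
  · exact Submodule.subset_span (Or.inl ⟨a, θ m, ha, map_smul θ a m⟩)
  · exact Submodule.subset_span (Or.inr ⟨i, θ m', h.map G θ⟩)

/-- Describes the kernel purely in terms of the R-module structure, so isomorphisms preserve it. -/
theorem ker_tagReduction (P : Set X) :
    LinearMap.ker (tagReduction (U := U) hJ P) = G.scaledSpan k (G.tagModule U P) := by
  classical
  apply le_antisymm
  · intro m hm
    obtain ⟨ρ, hρ, rfl⟩ := exists_mkTag m
    rw [LinearMap.mem_ker, tagReduction_mkTag] at hm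
    have hu : ∀ i, ((0, Finsupp.single i (ρ.2 i)) : FormalSum R ι X) ∈ tagSums U P := fun i =>
      single_mem_tagSums (hρ.2 i).1 (hρ.2 i).2
    have hx : ∀ x ∈ ρ.1.support, ((Finsupp.single x 1, 0) : FormalSum R ι X) ∈ tagSums U P :=
      fun x hx => fst_mem_tagSums (Finsupp.single_mem_supported R 1 (hρ.1 hx))
    -- Split f into multiples of basis vectors, with coefficients in the kernel of R → k, and split
    -- the rest into single products γ_i u_i.
    have hdec : (mkTag ρ hρ : G.tagModule U P) =
        (∑ x ∈ ρ.1.support.attach, ρ.1 x • mkTag (G := G) _ (hx x.1 x.2)) +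
          ∑ i ∈ ρ.2.support, mkTag (G := G) _ (hu i) := by
      apply Subtype.ext
      simp only [mkTag, Submodule.coe_add, Submodule.coe_sum, Submodule.coe_smul]
      rw [Finset.sum_attach ρ.1.support
        (fun x => ρ.1 x • G.value ((Finsupp.single x 1, 0) : FormalSum R ι X))]
      simp_rw [← map_smul, ← map_sum, ← map_add]
      congr 1
      refine Prod.ext ?_ ?_
      · simp only [Prod.fst_add, Prod.fst_sum, Prod.smul_fst, Finsupp.smul_single, smul_eq_mul,
          mul_one, Finset.sum_const_zero, add_zero]
        exact ρ.1.sum_single.symm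
      · simp only [Prod.snd_add, Prod.snd_sum, Prod.smul_snd, smul_zero,
          Finset.sum_const_zero, zero_add]
        exact ρ.2.sum_single.symm
    rw [hdec]
    refine Submodule.add_mem _ (Submodule.sum_mem _ fun x _ => ?_) (Submodule.sum_mem _ fun i _ => ?_)
    · refine Submodule.subset_span (Or.inl ⟨_, _, ?_, rfl⟩)
      simpa using DFunLike.congr_fun hm x.1
    · refine Submodule.subset_span (Or.inr ⟨i, mkTag _ (fst_mem_tagSums (hρ.2 i).1), ?_⟩)
      exact scaled_coe_iff.2 (G.scaled_value _ _)
  · refine Submodule.span_le.2 ?_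
    rintro _ (⟨a, m, ha, rfl⟩ | ⟨i, m', h⟩)
    · rw [SetLike.mem_coe, LinearMap.mem_ker, map_smul, ← algebraMap_smul k a, ha, zero_smul]
    · rename_i m
      obtain ⟨ρ, hρ, rfl⟩ := exists_mkTag m
      obtain ⟨ρ', hρ', rfl⟩ := exists_mkTag m'
      rw [SetLike.mem_coe, LinearMap.mem_ker, tagReduction_mkTag]
      exact G.reduction_eq_zero_of_scaled hJ (scaled_coe_iff.1 h)

theorem tagReduction_eq_zero_of_equiv {P P' : Set X} (θ : G.tagModule U P ≃ₗ[R] G.tagModule U P')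
    {m : G.tagModule U P} (hm : tagReduction hJ P m = 0) : tagReduction hJ P' (θ m) = 0 := by
  rw [← LinearMap.mem_ker, ker_tagReduction] at hm ⊢
  exact scaledSpan_le_comap θ.toLinearMap hm

/-- Modulo the invariant kernel, m may be replaced by a lift f of its reduction without γ-terms.
Both products γ_(i,b) f exist in the source; their images are the corresponding products in the
target and force membership in U_i. -/
theorem tagReduction_mem_of_equiv (hsurj : Function.Surjective (algebraMap R k)) {P P' : Set X}
    (θ : G.tagModule U P ≃ₗ[R] G.tagModule U P')
    {m : G.tagModule U P} {i : ι} (hm : tagReduction hJ P m ∈ U i) :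
    tagReduction hJ P' (θ m) ∈ U i := by
  obtain ⟨f, hf, hfm⟩ := exists_tagReduction_eq (R := R) hsurj (tagReduction_mem_supported hJ m)
  rw [← hfm] at hm
  let m₀ : G.tagModule U P := mkTag _ (fst_mem_tagSums hf)
  have hs : ∀ b, G.Scaled (i, b) m₀ (mkTag _ (single_mem_tagSums hf (i := (i, b)) hm)) :=
    fun b => scaled_coe_iff.2 (G.scaled_value _ _)
  have h0 : tagReduction hJ P' (θ (m - m₀)) = 0 := tagReduction_eq_zero_of_equiv hJ θ (by
    rw [map_sub, ← hfm, tagReduction_mkTag, sub_self])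
  rw [map_sub, map_sub, sub_eq_zero] at h0
  rw [h0]
  have h1 := (hs false).map G θ.toLinearMap
  have h2 := (hs true).map G θ.toLinearMap
  simp only [LinearEquiv.coe_coe] at h1 h2
  revert h1 h2
  obtain ⟨ρ, hρ, h⟩ := exists_mkTag (θ m₀)
  obtain ⟨ρ₁, hρ₁, h₁⟩ := exists_mkTag (θ (mkTag _ (single_mem_tagSums hf (i := (i, false)) hm)))
  obtain ⟨ρ₂, hρ₂, h₂⟩ := exists_mkTag (θ (mkTag _ (single_mem_tagSums hf (i := (i, true)) hm)))
  rw [h, h₁, h₂]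
  intro h1 h2
  rw [tagReduction_mkTag]
  exact G.reduction_mem_of_scaled_pair U hJ hρ₂ (scaled_coe_iff.1 h1) (scaled_coe_iff.1 h2)

/-- The element of `tagModule` attached to a basis vector. -/
noncomputable def basisTag {P : Set X} (x : P) : G.tagModule U P :=
  mkTag _ (fst_mem_tagSums (Finsupp.single_mem_supported R 1 x.2))

theorem tagReduction_basisTag {P : Set X} (x : P) :
    tagReduction hJ P (basisTag (G := G) (U := U) x) = Finsupp.single (x : X) 1 := by
  rw [basisTag, tagReduction_mkTag]
  simp

/-- If the image had two nonzero coordinates, it would lie in a monomial-free U_i; pulling back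
along θ would put a basis vector in U_i. -/
theorem exists_single_of_equiv (hsurj : Function.Surjective (algebraMap R k))
    (hmono : ∀ v : X →₀ k, 2 ≤ v.support.card → ∃ i, v ∈ U i ∧ NoMonomial (U i)) {P P' : Set X}
    (θ : G.tagModule U P ≃ₗ[R] G.tagModule U P') (x : P) :
    ∃ y : P', ∃ c : k, c ≠ 0 ∧
      tagReduction hJ P' (θ (basisTag x)) = Finsupp.single (y : X) c := by
  set v := tagReduction hJ P' (θ (basisTag x)) with hv
  have hv0 : v ≠ 0 := by
    intro h
    have := tagReduction_eq_zero_of_equiv hJ θ.symm h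
    rw [LinearEquiv.symm_apply_apply, tagReduction_basisTag] at this
    simp at this
  have hcard : v.support.card = 1 := by
    have h0 : v.support.card ≠ 0 := by simpa using hv0
    by_contra h1
    obtain ⟨i, hi, hno⟩ := hmono v (by omega)
    have := tagReduction_mem_of_equiv hJ hsurj θ.symm hi
    rw [LinearEquiv.symm_apply_apply, tagReduction_basisTag] at this
    exact one_ne_zero (hno _ _ this)
  obtain ⟨y, c, hc, hyc⟩ := Finsupp.card_support_eq_one'.1 hcard
  have hy : y ∈ P' := tagReduction_mem_supported hJ (θ (basisTag x)) (by
    rw [← hv, hyc, Finsupp.support_single _ hc]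
    simp)
  exact ⟨⟨y, hy⟩, c, hc, hyc⟩

theorem exists_equiv_of_equiv (hsurj : Function.Surjective (algebraMap R k))
    (hmono : ∀ v : X →₀ k, 2 ≤ v.support.card → ∃ i, v ∈ U i ∧ NoMonomial (U i)) {P P' : Set X}
    (θ : G.tagModule U P ≃ₗ[R] G.tagModule U P') :
    ∃ h : P ≃ P', ∀ x, (∃ c : k, c ≠ 0 ∧
      tagReduction hJ P' (θ (basisTag x)) = Finsupp.single (h x : X) c) ∧
        ∃ c : k, c ≠ 0 ∧
      tagReduction hJ P (θ.symm (basisTag (h x))) = Finsupp.single (x : X) c := by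
  choose f c hc hf using exists_single_of_equiv hJ hsurj hmono θ
  choose g d hd hg using exists_single_of_equiv hJ hsurj hmono θ.symm
  -- Lift the coefficient a to r in R: θ(e_x) - r e_y has zero reduction, and so has its image under
  -- the inverse, whence z = x.
  have key : ∀ (P P' : Set X) (θ : G.tagModule U P ≃ₗ[R] G.tagModule U P') (x : P) (y : P') (z : P)
      (a b : k), tagReduction hJ P' (θ (basisTag x)) = Finsupp.single (y : X) a →
      tagReduction hJ P (θ.symm (basisTag y)) = Finsupp.single (z : X) b → z = x := by
    intro P P' θ x y z a b ha hb
    obtain ⟨r, rfl⟩ := hsurj a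
    have := tagReduction_eq_zero_of_equiv hJ θ.symm (m := θ (basisTag x) - r • basisTag y) (by
      rw [map_sub, map_smul, tagReduction_basisTag, ha]
      simp [Algebra.smul_def])
    rw [map_sub, map_sub, map_smul, map_smul, LinearEquiv.symm_apply_apply, hb,
      tagReduction_basisTag, sub_eq_zero, Finsupp.smul_single, Finsupp.single_eq_single_iff] at this
    rcases this with h | h
    · exact Subtype.ext h.1.symm
    · exact absurd h.1 one_ne_zero
  have hgf : ∀ x, g (f x) = x := fun x => key P P' θ x (f x) _ _ _ (hf x) (hg _)
  refine ⟨⟨f, g, hgf, fun y => key P' P θ.symm y (g y) _ _ _ (hg y) (hf _)⟩,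
    fun x => ⟨⟨c x, hc x, hf x⟩, ⟨d (f x), hd _, ?_⟩⟩⟩
  have := hg (f x)
  rw [hgf] at this
  exact this

omit [Nonempty ι] in
theorem value_mem_tagModule_of_perm {P P' : Set X} (e : X ≃ X) (he : ∀ x ∈ P, e x ∈ P')
    (hU : ∀ i z, z ∈ U i → Finsupp.mapDomain e z ∈ U i) {m : X → ∀ n, R ⧸ G.K n}
    (hm : m ∈ G.tagModule U P) : LinearEquiv.funCongrLeft R (∀ n, R ⧸ G.K n) e.symm m ∈
      G.tagModule U P' := by
  classical
  obtain ⟨ρ, hρ, rfl⟩ := hm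
  have hsupp : ∀ z ∈ Finsupp.supported R R P, Finsupp.mapDomain e z ∈ Finsupp.supported R R P' := by
    intro z hz y hy
    obtain ⟨x, hx, rfl⟩ := Finset.mem_image.1 (Finsupp.mapDomain_support hy)
    exact he x (hz hx)
  have hred : ∀ z : X →₀ R, reduction R k X (Finsupp.mapDomain e z) =
      Finsupp.mapDomain e (reduction R k X z) := by
    intro z
    ext y
    obtain ⟨x, rfl⟩ := e.surjective y
    rw [reduction_apply, Finsupp.mapDomain_apply e.injective, Finsupp.mapDomain_apply e.injective,
      reduction_apply]
  refine ⟨(Finsupp.mapDomain e ρ.1, ρ.2.mapRange (Finsupp.mapDomain e) Finsupp.mapDomain_zero),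
    ⟨hsupp _ hρ.1, fun i => ⟨hsupp _ (hρ.2 i).1, ?_⟩⟩, ?_⟩
  · rw [Finsupp.mapRange_apply, hred]
    exact hU _ _ (hρ.2 i).2
  · ext y n
    obtain ⟨x, rfl⟩ := e.surjective y
    rw [LinearEquiv.funCongrLeft_apply, LinearMap.funLeft_apply, Equiv.symm_apply_apply,
      value_apply, value_apply, approx_apply, approx_apply, Finsupp.mapDomain_apply e.injective]
    have : coords (ρ.2.mapRange (Finsupp.mapDomain e) Finsupp.mapDomain_zero) (e x) =
        coords ρ.2 x := by
      ext i
      simp [coords, Finsupp.mapDomain_apply e.injective]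
    rw [this]

omit [Nonempty ι] in
theorem nonempty_equiv_of_perm {P P' : Set X} (e : X ≃ X) (he : ∀ x, x ∈ P ↔ e x ∈ P')
    (hU : ∀ i z, z ∈ U i ↔ Finsupp.mapDomain e z ∈ U i) :
    Nonempty (G.tagModule U P ≃ₗ[R] G.tagModule U P') := by
  refine ⟨LinearEquiv.ofSubmodules (LinearEquiv.funCongrLeft R (∀ n, R ⧸ G.K n) e.symm) _ _
    (le_antisymm ?_ fun m hm => ?_)⟩
  · rintro _ ⟨m, hm, rfl⟩
    exact value_mem_tagModule_of_perm e (fun x => (he x).1) (fun i z => (hU i z).1) hm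
  · refine ⟨_, value_mem_tagModule_of_perm e.symm (fun x hx => (he _).2 (by simpa using hx))
      (fun i z hz => (hU i _).2 ?_) hm, ?_⟩
    · rw [← Finsupp.mapDomain_comp]
      simpa using hz
    · ext x n
      simp [LinearEquiv.funCongrLeft_apply, LinearMap.funLeft_apply]

end GenericSystem

end TagModuleIso

/-! ## Coding structures by sets of cells -/

section Cells

variable {L : FirstOrder.Language.{0, 0}}

/-- The elements of `ℕ`, and the atomic facts about an `L`-structure with universe `ℕ`. -/
inductive Cell (L : FirstOrder.Language.{0, 0}) : Type
  | point (a : ℕ) : Cell L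
  | func {n : ℕ} (f : L.Functions n) (x : Fin n → ℕ) (y : ℕ) : Cell L
  | rel {n : ℕ} (r : L.Relations n) (x : Fin n → ℕ) (b : Bool) : Cell L

/-- The kinds of cells. -/
inductive CellLabel (L : FirstOrder.Language.{0, 0}) : Type
  | point : CellLabel L
  | func {n : ℕ} (f : L.Functions n) : CellLabel L
  | rel {n : ℕ} (r : L.Relations n) (b : Bool) : CellLabel L

theorem countable_functions (h : Countable L.Symbols) : Countable (Σ n, L.Functions n) :=
  (Sum.inl_injective : Function.Injective
    (Sum.inl : (Σ n, L.Functions n) → (Σ n, L.Functions n) ⊕ (Σ n, L.Relations n))).countable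

theorem countable_relations (h : Countable L.Symbols) : Countable (Σ n, L.Relations n) :=
  (Sum.inr_injective : Function.Injective
    (Sum.inr : (Σ n, L.Relations n) → (Σ n, L.Functions n) ⊕ (Σ n, L.Relations n))).countable

theorem Cell.countable (h : Countable L.Symbols) : Countable (Cell L) := by
  have := countable_functions h
  have := countable_relations h
  let F : (ℕ ⊕ (Σ f : (Σ n, L.Functions n), (Fin f.1 → ℕ) × ℕ) ⊕
      (Σ r : (Σ n, L.Relations n), (Fin r.1 → ℕ) × Bool)) → Cell L := fun s => match s with
    | .inl a => .point a
    | .inr (.inl ⟨f, x, y⟩) => .func f.2 x y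
    | .inr (.inr ⟨r, x, b⟩) => .rel r.2 x b
  refine Function.Surjective.countable (f := F) ?_
  rintro (a | ⟨f, x, y⟩ | ⟨r, x, b⟩)
  · exact ⟨.inl a, rfl⟩
  · exact ⟨.inr (.inl ⟨⟨_, f⟩, x, y⟩), rfl⟩
  · exact ⟨.inr (.inr ⟨⟨_, r⟩, x, b⟩), rfl⟩

namespace Cell

/-- The kind of a cell. -/
def label : Cell L → CellLabel L
  | point _ => .point
  | func f _ _ => .func f
  | rel r _ b => .rel r b

/-- The `j`-th entry of a cell, where the value of a function comes after the arguments. -/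
def entry (j : ℕ) : Cell L → Option ℕ
  | point a => some a
  | func (n := n) _ x y => if h : j < n then some (x ⟨j, h⟩) else some y
  | rel (n := n) _ x _ => if h : j < n then some (x ⟨j, h⟩) else none

/-- The action of a map `ℕ → ℕ` on cells. -/
def map (σ : ℕ → ℕ) : Cell L → Cell L
  | point a => point (σ a)
  | func f x y => func f (σ ∘ x) (σ y)
  | rel r x b => rel r (σ ∘ x) b

theorem label_map (σ : ℕ → ℕ) (c : Cell L) : (c.map σ).label = c.label := by
  cases c <;> rfl

theorem entry_map (σ : ℕ → ℕ) (j : ℕ) (c : Cell L) : (c.map σ).entry j = (c.entry j).map σ := by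
  cases c <;> simp only [map, entry, Option.map_some] <;> split_ifs <;> rfl

theorem map_map (σ τ : ℕ → ℕ) (c : Cell L) : (c.map σ).map τ = c.map (τ ∘ σ) := by
  cases c <;> rfl

theorem map_id (c : Cell L) : c.map id = c := by
  cases c <;> rfl

/-- The permutation of the cells induced by a permutation of `ℕ`. -/
def mapEquiv (σ : ℕ ≃ ℕ) : Cell L ≃ Cell L where
  toFun := map σ
  invFun := map σ.symm
  left_inv c := by rw [map_map, Equiv.symm_comp_self, map_id]
  right_inv c := by rw [map_map, Equiv.self_comp_symm, map_id]

end Cell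

/-- The set of cells which are true in a structure. -/
def cells (A : L.Structure ℕ) : Set (Cell L) :=
  {c | match c with
    | .point _ => True
    | .func f x y => A.funMap f x = y
    | .rel r x b => A.RelMap r x ↔ b = true}

theorem structureIso_iff {L : FirstOrder.Language.{u, v}} {A A' : L.Structure ℕ} :
    StructureIso A A' ↔ ∃ σ : ℕ ≃ ℕ,
      (∀ {n} (f : L.Functions n) (x : Fin n → ℕ), σ (A.funMap f x) = A'.funMap f (σ ∘ x)) ∧
      ∀ {n} (r : L.Relations n) (x : Fin n → ℕ), A'.RelMap r (σ ∘ x) ↔ A.RelMap r x :=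
  ⟨fun ⟨σ⟩ => ⟨@FirstOrder.Language.Equiv.toEquiv L ℕ ℕ A A' σ,
      fun f x => @FirstOrder.Language.Equiv.map_fun' L ℕ ℕ A A' σ _ f x,
      fun r x => @FirstOrder.Language.Equiv.map_rel' L ℕ ℕ A A' σ _ r x⟩,
    fun ⟨σ, hf, hr⟩ => ⟨@FirstOrder.Language.Equiv.mk L ℕ ℕ A A' σ (fun f x => hf f x)
      (fun r x => hr r x)⟩⟩

theorem map_mem_cells_iff {A A' : L.Structure ℕ} (σ : ℕ ≃ ℕ)
    (hf : ∀ {n} (f : L.Functions n) (x : Fin n → ℕ), σ (A.funMap f x) = A'.funMap f (σ ∘ x))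
    (hr : ∀ {n} (r : L.Relations n) (x : Fin n → ℕ), A'.RelMap r (σ ∘ x) ↔ A.RelMap r x)
    (c : Cell L) : c ∈ cells A ↔ c.map σ ∈ cells A' := by
  cases c with
  | point a => exact Iff.rfl
  | func f x y =>
    change A.funMap f x = y ↔ A'.funMap f (σ ∘ x) = σ y
    rw [← hf, σ.injective.eq_iff]
  | rel r x b =>
    change (A.RelMap r x ↔ b = true) ↔ (A'.RelMap r (σ ∘ x) ↔ b = true)
    rw [hr]

/-- The points over the true cells of a structure. -/
def cellSet (A : L.Structure ℕ) : Set (Cell L × ℕ) := {x | x.1 ∈ cells A}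

/-- Point cells are recognised by their label and have their number as entry at every position. They
thus yield a permutation σ of ℕ, and comparing entries with point cells shows that every other cell
is moved by σ. The choice of copy in ℕ plays no role. -/
theorem structureIso_of_cellSet_equiv {A A' : L.Structure ℕ} (h : cellSet A ≃ cellSet A')
    (hl : ∀ x, (h x).1.1.label = x.1.1.label)
    (hp : ∀ j x y, x.1.1.entry j = y.1.1.entry j ↔ (h x).1.1.entry j = (h y).1.1.entry j) :
    StructureIso A A' := by
  let pt (B : L.Structure ℕ) (a : ℕ) : cellSet B := ⟨(.point a, 0), trivial⟩
  have hpoint : ∀ (B : L.Structure ℕ) (x : cellSet B), x.1.1.label = .point →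
      ∃ a, x.1.1 = .point a := by
    rintro B ⟨⟨c, n⟩, hc⟩ hx
    cases c with
    | point a => exact ⟨a, rfl⟩
    | func f x y => cases hx
    | rel r x b => cases hx
  choose σ hσ using fun a => hpoint A' (h (pt A a)) (hl _)
  have hent : ∀ (x : cellSet A) j a, x.1.1.entry j = some a ↔ (h x).1.1.entry j = some (σ a) := by
    intro x j a
    have := hp j x (pt A a)
    rw [hσ a] at this
    exact this
  have hinj : Function.Injective σ := by
    intro a b hab
    have := (hent (pt A a) 0 b).2 (by rw [hσ, hab]; rfl)
    exact Option.some.inj this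
  have hsurj : Function.Surjective σ := by
    intro b
    obtain ⟨a, ha⟩ := hpoint A (h.symm (pt A' b)) (by
      rw [← hl, Equiv.apply_symm_apply]; rfl)
    refine ⟨a, ?_⟩
    have := (hent (h.symm (pt A' b)) 0 a).1 (by rw [ha]; rfl)
    rw [Equiv.apply_symm_apply] at this
    exact (Option.some.inj this).symm
  refine structureIso_iff.2 ⟨Equiv.ofBijective σ ⟨hinj, hsurj⟩, ?_, ?_⟩
  · intro n f x
    have hmem : (Cell.func f x (A.funMap f x), 0) ∈ cellSet A := rfl
    have hl' := hl ⟨_, hmem⟩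
    have he := hent ⟨_, hmem⟩
    revert hl' he
    obtain ⟨⟨c, m⟩, hc⟩ := h ⟨_, hmem⟩
    intro hl' he
    cases c with
    | point a => cases hl'
    | rel r x b => cases hl'
    | func f' x' y' =>
      cases hl'
      have hc' : A'.funMap f x' = y' := hc
      have hx' : x' = σ ∘ x := by
        funext i
        have := (he i (x i)).1 (by simp [Cell.entry])
        simpa [Cell.entry] using this
      -- Entry n, just past the n arguments, is the value of the function.
      have hy' : y' = σ (A.funMap f x) := by
        have := (he n (A.funMap f x)).1 (by simp [Cell.entry])
        simpa [Cell.entry] using this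
      change σ (A.funMap f x) = A'.funMap f (σ ∘ x)
      rw [← hx', hc', hy']
  · intro n r x
    classical
    have hmem : (Cell.rel r x (decide (A.RelMap r x)), 0) ∈ cellSet A :=
      (decide_eq_true_iff (p := A.RelMap r x)).symm
    have hl' := hl ⟨_, hmem⟩
    have he := hent ⟨_, hmem⟩
    revert hl' he
    obtain ⟨⟨c, m⟩, hc⟩ := h ⟨_, hmem⟩
    intro hl' he
    cases c with
    | point a => cases hl'
    | func f x y => cases hl'
    | rel r' x' b' =>
      cases hl'
      have hc' : A'.RelMap r x' ↔ decide (A.RelMap r x) = true := hc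
      have hx' : x' = σ ∘ x := by
        funext i
        have := (he i (x i)).1 (by simp [Cell.entry])
        simpa [Cell.entry] using this
      change A'.RelMap r (σ ∘ x) ↔ A.RelMap r x
      rw [← hx', hc', decide_eq_true_iff]

end Cells

/-! ### A Borel assignment of submodules to structures -/

section Assignment

variable {L : FirstOrder.Language.{0, 0}}

theorem measurableSet_mem_cells (c : Cell L) : MeasurableSet {A : L.Structure ℕ | c ∈ cells A} := by
  cases c with
  | point a => exact MeasurableSet.univ
  | func f x y =>
    refine MeasurableSpace.measurableSet_generateFrom (TopologicalSpace.isOpen_generateFrom_of_mem ?_)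
    exact Or.inl (Or.inl ⟨_, f, x, y, rfl⟩)
  | rel r x b =>
    refine MeasurableSpace.measurableSet_generateFrom (TopologicalSpace.isOpen_generateFrom_of_mem ?_)
    cases b with
    | true => exact Or.inl (Or.inr ⟨_, r, x, by simp [cells]⟩)
    | false => exact Or.inr ⟨_, r, x, by simp [cells]⟩

/-- Membership means having one of countably many formal sums as representative; for a fixed sum the
only dependence on the structure is that finitely supported vectors live on true cells. -/
theorem measurableSet_mem_tagModule {R : Type u} [CommRing R] [Countable R] {ι : Type v}
    [Countable ι] (G : GenericSystem R (ι × Bool)) {k : Type u'} [Field k] [Algebra R k]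
    [Countable (Cell L)] (U : ι → Submodule k (Cell L × ℕ →₀ k)) (m) :
    MeasurableSet {A : L.Structure ℕ | m ∈ G.tagModule U (cellSet A)} := by
  have hsupp : ∀ z : Cell L × ℕ →₀ R,
      MeasurableSet {A : L.Structure ℕ | z ∈ Finsupp.supported R R (cellSet A)} := by
    intro z
    have : {A : L.Structure ℕ | z ∈ Finsupp.supported R R (cellSet A)} =
        ⋂ x ∈ z.support, {A : L.Structure ℕ | x.1 ∈ cells A} := by
      ext A
      simp only [Set.mem_iInter]
      exact Iff.rfl
    rw [this]
    exact Finset.measurableSet_biInter _ fun x _ => measurableSet_mem_cells x.1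
  have : {A : L.Structure ℕ | m ∈ G.tagModule U (cellSet A)} =
      ⋃ ρ : FormalSum R ι (Cell L × ℕ), ⋃ _ : G.value ρ = m,
        ({A | ρ.1 ∈ Finsupp.supported R R (cellSet A)} ∩
          ⋂ i, ({A | ρ.2 i ∈ Finsupp.supported R R (cellSet A)} ∩
            {_A | reduction R k _ (ρ.2 i) ∈ U i.1})) := by
    ext A
    simp only [Set.mem_iUnion, Set.mem_inter_iff, Set.mem_iInter]
    exact ⟨fun ⟨ρ, h, h'⟩ => ⟨ρ, h', h⟩, fun ⟨ρ, h', h⟩ => ⟨ρ, h, h'⟩⟩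
  rw [this]
  exact MeasurableSet.iUnion fun ρ => MeasurableSet.iUnion fun _ =>
    (hsupp _).inter (MeasurableSet.iInter fun i => (hsupp _).inter (MeasurableSet.const _))

/-- A countable module, and an assignment of submodules to structures which reduces isomorphism of
structures to isomorphism of modules. -/
theorem exists_submodule_assignment {R : Type u} [CommRing R] [Countable R] (I : ℕ → Ideal R)
    (hann : ∀ n, IsAnnihilatorIdeal (I n)) (hne : ∀ n, I n ≠ ⊥)
    (hdesc : ∀ n, I (n + 1) ≤ I n) (hinter : ⨅ n, I n = ⊥)
    (L : FirstOrder.Language.{0, 0}) (hL : Countable L.Symbols) :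
    ∃ (W : Type u) (_ : AddCommGroup W) (_ : Module R W) (S : L.Structure ℕ → Submodule R W),
      Countable W ∧ (∀ A, Infinite (S A)) ∧ (∀ m, MeasurableSet {A | m ∈ S A}) ∧
        ∀ A A', Nonempty (S A ≃ₗ[R] S A') ↔ StructureIso A A' := by
  classical
  obtain ⟨G⟩ := GenericSystem.nonempty I hann hne hdesc hinter (ℕ × Bool)
  obtain ⟨𝔪, h𝔪, hle⟩ := Ideal.exists_le_maximal G.J G.J_ne_top
  let : Field (R ⧸ 𝔪) := Ideal.Quotient.field 𝔪
  let k := R ⧸ 𝔪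
  have hsurj : Function.Surjective (algebraMap R k) := Ideal.Quotient.mk_surjective
  have hJ : ∀ a ∈ G.J, algebraMap R k a = 0 := fun a ha =>
    Ideal.Quotient.eq_zero_iff_mem.2 (hle ha)
  have : Countable k := hsurj.countable
  have := Cell.countable hL
  have hLab : Countable (CellLabel L) := by
    have := countable_functions hL
    have := countable_relations hL
    refine Function.Surjective.countable
      (f := fun s : Unit ⊕ (Σ n, L.Functions n) ⊕ (Σ n, L.Relations n) × Bool => match s with
        | .inl _ => CellLabel.point
        | .inr (.inl f) => .func f.2
        | .inr (.inr (r, b)) => .rel r.2 b) ?_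
    rintro (_ | f | ⟨r, b⟩)
    · exact ⟨.inl (), rfl⟩
    · exact ⟨.inr (.inl ⟨_, f⟩), rfl⟩
    · exact ⟨.inr (.inr (⟨_, r⟩, b)), rfl⟩
  have : Nonempty (Cell L) := ⟨.point 0⟩
  obtain ⟨𝓕⟩ := RichFamily.nonempty k (Cell.label (L := L)) Cell.entry
  choose T hT1 hT2 hT3 using 𝓕.closed
  -- Three kinds of tags: rigidity for each vector with at least two nonzero coordinates, labels,
  -- and equality of j-th entries. All are closed under the rich family.
  let tag : {v : Cell L × ℕ →₀ k // 2 ≤ v.support.card} ⊕ CellLabel L ⊕ ℕ →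
      Submodule k (Cell L × ℕ →₀ k) := fun s => match s with
    | .inl v => T v.1 v.2
    | .inr (.inl c) => labelTag k Cell.label c
    | .inr (.inr j) => projTag k Cell.entry j
  have htag : ∀ s, ∀ f ∈ 𝓕.maps, GraphClosed f (tag s) := by
    rintro (v | c | j) f hf
    · exact hT3 _ _ f hf
    · exact (𝓕.adm f hf).labelTag_closed c
    · exact (𝓕.adm f hf).projTag_closed j
  obtain ⟨en, hen⟩ := exists_surjective_nat
    ({v : Cell L × ℕ →₀ k // 2 ≤ v.support.card} ⊕ CellLabel L ⊕ ℕ)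
  let U : ℕ → Submodule k (Cell L × ℕ →₀ k) := fun i => tag (en i)
  have hUlabel : ∀ c, ∃ i, U i = labelTag k Cell.label c := fun c => by
    obtain ⟨i, hi⟩ := hen (.inr (.inl c))
    exact ⟨i, by simp only [U, hi, tag]⟩
  have hUproj : ∀ j, ∃ i, U i = projTag k Cell.entry j := fun j => by
    obtain ⟨i, hi⟩ := hen (.inr (.inr j))
    exact ⟨i, by simp only [U, hi, tag]⟩
  have hUmono : ∀ v : Cell L × ℕ →₀ k, 2 ≤ v.support.card → ∃ i, v ∈ U i ∧ NoMonomial (U i) := by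
    intro v hv
    obtain ⟨i, hi⟩ := hen (.inl ⟨v, hv⟩)
    exact ⟨i, by simp only [U, hi, tag]; exact hT1 v hv, by simp only [U, hi, tag]; exact hT2 v hv⟩
  -- The values of all formal sums: one countable module containing every `tagModule`.
  let W := LinearMap.range (G.value (X := Cell L × ℕ))
  have hSle : ∀ A : L.Structure ℕ, G.tagModule U (cellSet A) ≤ W := fun A =>
    LinearMap.map_le_range
  let S : L.Structure ℕ → Submodule R W := fun A => (G.tagModule U (cellSet A)).comap W.subtype
  let ε : ∀ A, S A ≃ₗ[R] G.tagModule U (cellSet A) := fun A =>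
    Submodule.comapSubtypeEquivOfLe (hSle A)
  refine ⟨W, inferInstance, inferInstance, S, ?_, fun A => ?_, fun m => ?_, fun A A' => ⟨?_, ?_⟩⟩
  · exact (LinearMap.surjective_rangeRestrict (G.value (X := Cell L × ℕ))).countable
  · have : Infinite (G.tagModule U (cellSet A)) := by
      refine Infinite.of_injective
        (fun n : ℕ => GenericSystem.basisTag (P := cellSet A) ⟨(.point n, 0), trivial⟩) ?_
      intro a b hab
      have := congrArg (GenericSystem.tagReduction hJ (cellSet A)) hab
      simp only [GenericSystem.tagReduction_basisTag] at this
      rcases (Finsupp.single_eq_single_iff _ _ _ _).1 this with h | h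
      · simpa using h.1
      · exact absurd h.1 one_ne_zero
    exact Infinite.of_injective (ε A).symm (ε A).symm.injective
  · exact measurableSet_mem_tagModule G U m.1
  · rintro ⟨θ'⟩
    let θ : G.tagModule U (cellSet A) ≃ₗ[R] G.tagModule U (cellSet A') :=
      ((ε A).symm.trans θ').trans (ε A')
    obtain ⟨h, hh⟩ := GenericSystem.exists_equiv_of_equiv hJ hsurj hUmono θ
    refine structureIso_of_cellSet_equiv h (fun x => ?_) fun j x y => ⟨fun hxy => ?_, fun hxy => ?_⟩
    · obtain ⟨i, hi⟩ := hUlabel x.1.1.label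
      obtain ⟨⟨c, hc, hxc⟩, -⟩ := hh x
      have h1 : GenericSystem.tagReduction (U := U) hJ (cellSet A) (GenericSystem.basisTag x) ∈ U i := by
        rw [GenericSystem.tagReduction_basisTag, hi, single_mem_labelTag one_ne_zero]
      have h2 := GenericSystem.tagReduction_mem_of_equiv hJ hsurj θ h1
      rwa [hxc, hi, single_mem_labelTag hc] at h2
    · obtain ⟨i, hi⟩ := hUproj j
      obtain ⟨⟨c, hc, hxc⟩, -⟩ := hh x
      obtain ⟨⟨d, hd, hyd⟩, -⟩ := hh y
      have h1 : GenericSystem.tagReduction (U := U) hJ (cellSet A)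
          (GenericSystem.basisTag x - GenericSystem.basisTag y) ∈ U i := by
        rw [map_sub, GenericSystem.tagReduction_basisTag, GenericSystem.tagReduction_basisTag, hi]
        exact single_sub_mem_projTag hxy
      have h2 := GenericSystem.tagReduction_mem_of_equiv hJ hsurj θ h1
      rw [map_sub, map_sub, hxc, hyd, hi] at h2
      exact eq_of_single_sub_mem_projTag hc h2
    · obtain ⟨i, hi⟩ := hUproj j
      obtain ⟨-, c, hc, hxc⟩ := hh x
      obtain ⟨-, d, hd, hyd⟩ := hh y
      have h1 : GenericSystem.tagReduction (U := U) hJ (cellSet A')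
          (GenericSystem.basisTag (h x) - GenericSystem.basisTag (h y)) ∈ U i := by
        rw [map_sub, GenericSystem.tagReduction_basisTag, GenericSystem.tagReduction_basisTag, hi]
        exact single_sub_mem_projTag hxy
      have h2 := GenericSystem.tagReduction_mem_of_equiv hJ hsurj θ.symm h1
      rw [map_sub, map_sub, hxc, hyd, hi] at h2
      exact eq_of_single_sub_mem_projTag hc h2
  · intro hiso
    obtain ⟨σ, hf, hr⟩ := structureIso_iff.1 hiso
    obtain ⟨e, he, heU⟩ := 𝓕.exists_perm (Cell.mapEquiv σ) (Cell.label_map σ) (fun j a b => by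
      change _ ↔ (a.map σ).entry j = (b.map σ).entry j
      rw [Cell.entry_map, Cell.entry_map, (Option.map_injective σ.injective).eq_iff])
    obtain ⟨θ⟩ := GenericSystem.nonempty_equiv_of_perm (G := G) (U := U) (P := cellSet A)
      (P' := cellSet A') e
      (fun x => by
        change x.1 ∈ cells A ↔ (e x).1 ∈ cells A'
        rw [he]
        exact map_mem_cells_iff σ hf hr x.1)
      (fun i => heU (U i) (htag (en i)))
    exact ⟨((ε A).trans θ).trans (ε A').symm⟩

end Assignment

/-! ## Borel enumerations and the main theorem -/

section Borel

/-- Enumerate each set in the order of a fixed injection c of W into ℕ. Being the n-th element means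
being a member with exactly n members of smaller code, a Borel condition. -/
theorem exists_measurable_enumeration {Ω : Type u} [MeasurableSpace Ω] {W : Type v} [Countable W]
    (S : Ω → Set W) (hinf : ∀ ω, (S ω).Infinite) (hmeas : ∀ m, MeasurableSet {ω | m ∈ S ω}) :
    ∃ E : ∀ ω, ℕ ≃ S ω, ∀ n m, MeasurableSet {ω | (E ω n : W) = m} := by
  classical
  obtain ⟨c, hc⟩ := exists_injective_nat W
  let p : Ω → ℕ → Prop := fun ω i => ∃ m ∈ S ω, c m = i
  have hp : ∀ ω, (Set.ofPred (p ω)).Infinite := fun ω => (hinf ω).image hc.injOn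
  have hpc : ∀ ω m, p ω (c m) ↔ m ∈ S ω := fun ω m =>
    ⟨fun ⟨m', h, h'⟩ => hc h' ▸ h, fun h => ⟨m, h, rfl⟩⟩
  have hpmeas : ∀ i, MeasurableSet {ω | p ω i} := by
    intro i
    have : {ω | p ω i} = ⋃ m, ⋃ _ : c m = i, {ω | m ∈ S ω} := by
      ext ω
      simp only [Set.mem_iUnion]
      exact ⟨fun ⟨m, h, h'⟩ => ⟨m, h', h⟩, fun ⟨m, h', h⟩ => ⟨m, h, h'⟩⟩
    rw [this]
    exact MeasurableSet.iUnion fun m => MeasurableSet.iUnion fun _ => hmeas m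
  have hcount : ∀ i, Measurable fun ω => Nat.count (p ω) i := by
    intro i
    induction i with
    | zero => simp
    | succ i ih =>
      simp only [Nat.count_succ]
      exact ih.add (Measurable.ite (hpmeas i) measurable_const measurable_const)
  choose f hfS hfc using fun ω n => Nat.nth_mem_of_infinite (hp ω) n
  have hbij : ∀ ω, Function.Bijective fun n => (⟨f ω n, hfS ω n⟩ : S ω) := by
    intro ω
    refine ⟨fun a b hab => ?_, fun m => ⟨Nat.count (p ω) (c m), Subtype.ext (hc ?_)⟩⟩
    · have : c (f ω a) = c (f ω b) := congrArg (fun m : S ω => c m) hab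
      rw [hfc, hfc] at this
      exact Nat.nth_injective (hp ω) this
    · change c (f ω _) = c m
      rw [hfc, Nat.nth_count ((hpc ω m).2 m.2)]
  refine ⟨fun ω => Equiv.ofBijective _ (hbij ω), fun n m => ?_⟩
  have : {ω | (Equiv.ofBijective _ (hbij ω) n : W) = m} =
      {ω | m ∈ S ω} ∩ (fun ω => Nat.count (p ω) (c m)) ⁻¹' {n} := by
    ext ω
    change f ω n = m ↔ m ∈ S ω ∧ Nat.count (p ω) (c m) = n
    constructor
    · rintro rfl
      exact ⟨hfS ω n, by rw [hfc, Nat.count_nth_of_infinite (hp ω)]⟩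
    · rintro ⟨h, rfl⟩
      exact hc (by rw [hfc, Nat.nth_count ((hpc ω m).2 h)])
  rw [this]
  exact (hmeas m).inter (hcount _ (measurableSet_singleton n))

/-! ### Modules as structures with universe ℕ -/

variable {R : Type u} [CommRing R] {M : Type v} [AddCommGroup M] [Module R M]

/-- The structure on `ℕ` obtained from a module by transport along a bijection. -/
abbrev transportedStructure (E : ℕ ≃ M) : (moduleLanguage R).Structure ℕ where
  funMap {n} f x := match n, (f : ModuleFunc R n), x with
    | _, .zero, _ => E.symm 0
    | _, .add, x => E.symm (E (x 0) + E (x 1))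
    | _, .smul r, x => E.symm (r • E (x 0))
  RelMap {_} r _ := (nomatch (r : Empty))

theorem transportedStructure_mem (E : ℕ ≃ M) :
    transportedStructure E ∈ ModelsOf (moduleTheory R) := by
  let := transportedStructure (R := R) E
  have hz : ∀ n (x : Fin n → ℕ), (ModuleTerm.zero : (moduleLanguage R).Term (Fin n)).realize x =
      E.symm 0 := fun n x => rfl
  have ha : ∀ n (x : Fin n → ℕ) (s t : (moduleLanguage R).Term (Fin n)),
      (ModuleTerm.add s t).realize x = E.symm (E (s.realize x) + E (t.realize x)) :=
    fun n x s t => rfl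
  have hs : ∀ n (x : Fin n → ℕ) r (t : (moduleLanguage R).Term (Fin n)),
      (ModuleTerm.smul r t).realize x = E.symm (r • E (t.realize x)) := fun n x r t => rfl
  have hx : ∀ n (x : Fin n → ℕ) (i : Fin n),
      (ModuleTerm.x i : (moduleLanguage R).Term (Fin n)).realize x = x i := fun n x i => rfl
  rintro _ ⟨a, rfl⟩
  cases a with
  | addNeg =>
    intro a
    refine ⟨E.symm (-E a), ?_⟩
    simp [InfFormula.Realize, hz, ha, hx, Fin.snoc]
  | _ =>
    simp [ModuleAxiom.toSentence, InfFormula.Realize, hz, ha, hs, hx, Fin.snoc, add_comm,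
      add_left_comm, add_smul, mul_smul]

theorem structureIso_transportedStructure_iff {M' : Type w} [AddCommGroup M'] [Module R M']
    (E : ℕ ≃ M) (E' : ℕ ≃ M') :
    StructureIso (transportedStructure (R := R) E) (transportedStructure (R := R) E') ↔
      Nonempty (M ≃ₗ[R] M') := by
  rw [structureIso_iff]
  constructor
  · rintro ⟨σ, hf, -⟩
    refine ⟨{ (E.symm.trans σ).trans E' with
      map_add' := fun a b => ?_, map_smul' := fun r a => ?_ }⟩
    · have : σ (E.symm (E (E.symm a) + E (E.symm b))) =
          E'.symm (E' (σ (E.symm a)) + E' (σ (E.symm b))) :=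
        hf (ModuleFunc.add : ModuleFunc R 2) ![E.symm a, E.symm b]
      simp only [Equiv.apply_symm_apply] at this
      simp [this]
    · have : σ (E.symm (r • E (E.symm a))) = E'.symm (r • E' (σ (E.symm a))) :=
        hf (ModuleFunc.smul r : ModuleFunc R 1) ![E.symm a]
      simp only [Equiv.apply_symm_apply] at this
      simp [this]
  · rintro ⟨θ⟩
    refine ⟨(E.trans θ.toEquiv).trans E'.symm, fun {n} f x => ?_, fun {n} r => nomatch (r : Empty)⟩
    change ModuleFunc R n at f
    cases f with
    | zero =>
      change E'.symm (θ (E (E.symm 0))) = E'.symm 0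
      simp
    | add =>
      change E'.symm (θ (E (E.symm (E (x 0) + E (x 1))))) =
        E'.symm (E' (E'.symm (θ (E (x 0)))) + E' (E'.symm (θ (E (x 1)))))
      simp
    | smul r =>
      change E'.symm (θ (E (E.symm (r • E (x 0))))) = E'.symm (r • E' (E'.symm (θ (E (x 0)))))
      simp

/-- The language is countable, so the Borel sets are generated by the countable subbasis; each of
its conditions becomes a countable union over the values in M of the enumerated elements. -/
theorem measurable_transportedStructure [Countable R] {Ω : Type w} [MeasurableSpace Ω] [Countable M]
    (S : Ω → Submodule R M) (E : ∀ ω, ℕ ≃ S ω)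
    (hE : ∀ n m, MeasurableSet {ω | (E ω n : M) = m}) :
    Measurable fun ω => transportedStructure (R := R) (E ω) := by
  have hcf : Countable (Σ n, ModuleFunc R n) := by
    refine Function.Surjective.countable (f := fun s : Option (Option R) =>
      (match s with
        | none => ⟨0, .zero⟩
        | some none => ⟨2, .add⟩
        | some (some r) => ⟨1, .smul r⟩ : Σ n, ModuleFunc R n)) ?_
    rintro ⟨_, _ | _ | r⟩
    · exact ⟨none, rfl⟩
    · exact ⟨some none, rfl⟩
    · exact ⟨some (some r), rfl⟩
  let B : Set (Set ((moduleLanguage R).Structure ℕ)) :=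
    Set.range fun s : Σ f : (Σ n, ModuleFunc R n), (Fin f.1 → ℕ) × ℕ =>
      {N : (moduleLanguage R).Structure ℕ |
        N.funMap (s.1.2 : (moduleLanguage R).Functions s.1.1) s.2.1 = s.2.2}
  have htop : structureTopology (moduleLanguage R) = TopologicalSpace.generateFrom B := by
    refine congrArg TopologicalSpace.generateFrom (Set.ext fun V => ⟨?_, ?_⟩)
    · rintro ((⟨n, f, x, y, rfl⟩ | ⟨n, r, x, rfl⟩) | ⟨n, r, x, rfl⟩)
      · exact ⟨⟨⟨n, f⟩, x, y⟩, rfl⟩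
      · exact nomatch (r : Empty)
      · exact nomatch (r : Empty)
    · rintro ⟨⟨⟨n, f⟩, x, y⟩, rfl⟩
      exact Or.inl (Or.inl ⟨n, f, x, y, rfl⟩)
  have : SecondCountableTopology ((moduleLanguage R).Structure ℕ) :=
    ⟨⟨B, Set.countable_range _, htop⟩⟩
  have hborel : structureMeasurableSpace (moduleLanguage R) = MeasurableSpace.generateFrom B :=
    borel_eq_generateFrom_of_subbasis htop
  rw [hborel]
  refine measurable_generateFrom ?_
  rintro _ ⟨⟨⟨n, f⟩, x, y⟩, rfl⟩
  cases f with
  | zero =>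
    convert hE y 0 using 1
    ext ω
    change (E ω).symm 0 = y ↔ (E ω y : M) = 0
    rw [Equiv.symm_apply_eq, Subtype.ext_iff, eq_comm]
    rfl
  | add =>
    have : (fun ω => transportedStructure (R := R) (E ω)) ⁻¹'
        {N | N.funMap (ModuleFunc.add : ModuleFunc R 2) x = y} =
        ⋃ p : M, ⋃ q : M, {ω | (E ω (x 0) : M) = p} ∩ {ω | (E ω (x 1) : M) = q} ∩
          {ω | (E ω y : M) = p + q} := by
      ext ω
      simp only [Set.mem_iUnion]
      change (E ω).symm (E ω (x 0) + E ω (x 1)) = y ↔ ∃ p q, ((E ω (x 0) : M) = p ∧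
        (E ω (x 1) : M) = q) ∧ (E ω y : M) = p + q
      rw [Equiv.symm_apply_eq, Subtype.ext_iff, eq_comm]
      exact ⟨fun h => ⟨_, _, ⟨rfl, rfl⟩, h⟩, by rintro ⟨_, _, ⟨rfl, rfl⟩, h⟩; exact h⟩
    change MeasurableSet ((fun ω => transportedStructure (R := R) (E ω)) ⁻¹'
        {N | N.funMap (ModuleFunc.add : ModuleFunc R 2) x = y})
    rw [this]
    exact MeasurableSet.iUnion fun p => MeasurableSet.iUnion fun q =>
      ((hE _ _).inter (hE _ _)).inter (hE _ _)
  | smul r =>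
    have : (fun ω => transportedStructure (R := R) (E ω)) ⁻¹'
        {N | N.funMap (ModuleFunc.smul r : ModuleFunc R 1) x = y} =
        ⋃ p : M, {ω | (E ω (x 0) : M) = p} ∩ {ω | (E ω y : M) = r • p} := by
      ext ω
      simp only [Set.mem_iUnion]
      change (E ω).symm (r • E ω (x 0)) = y ↔ ∃ p, (E ω (x 0) : M) = p ∧ (E ω y : M) = r • p
      rw [Equiv.symm_apply_eq, Subtype.ext_iff, eq_comm]
      exact ⟨fun h => ⟨_, rfl, h⟩, by rintro ⟨_, rfl, h⟩; exact h⟩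
    change MeasurableSet ((fun ω => transportedStructure (R := R) (E ω)) ⁻¹'
        {N | N.funMap (ModuleFunc.smul r : ModuleFunc R 1) x = y})
    rw [this]
    exact MeasurableSet.iUnion fun p => (hE _ _).inter (hE _ _)

end Borel

theorem mainTheorem5 {R : Type u} [CommRing R] [Countable R] (I : ℕ → Ideal R)
    (hann : ∀ n, IsAnnihilatorIdeal (I n)) (hne : ∀ n, I n ≠ ⊥)
    (hdesc : ∀ n, I (n + 1) ≤ I n) (hinter : ⨅ n, I n = ⊥) :
    IsBorelComplete (moduleTheory R) := by
  intro L hL T _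
  obtain ⟨W, _, _, S, hW, hinf, hmeas, hiso⟩ :=
    exists_submodule_assignment I hann hne hdesc hinter L hL
  obtain ⟨E, hE⟩ := exists_measurable_enumeration (fun A => (S A : Set W))
    (fun A => Set.infinite_coe_iff.1 (hinf A)) hmeas
  refine ⟨fun A => ⟨transportedStructure (M := S A.1) (E A.1), transportedStructure_mem _⟩, ?_,
    fun A A' => ?_⟩
  · exact ((measurable_transportedStructure S E hE).comp measurable_subtype_coe).subtype_mk
  · rw [← hiso]
    exact structureIso_transportedStructure_iff _ _
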